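/- **Setting.** Let $k$ be a field of characteristic different from $2$ and $3$, with separable closure $k^{\mathrm s}$. Let $\mathbb O$ be an octonion algebra over $k$ with norm $N$, conjugation $x\mapsto\bar x$ and trace $\mathrm{tr}(x)=x+\bar x$. Let $J$ be the space of Hermitian matrices $$X=\begin{pmatrix} s_1&x_3&\overline{x_2}\\ \overline{x_3}&s_2&x_1\\ x_2&\overline{x_1}&s_3\end{pmatrix},\qquad s_i\in k,\ x_i\in\mathbb O,$$ with the Jordan product $X\circ Y=\frac12(XY+YX)$, the unit $e=I_3$, $\mathrm{Tr}(X)=s_1+s_2+s_3$ and the cubic form $\det X=s_1s_2s_3+\mathrm{tr}(x_1x_2x_3)-\sum_i s_iN(x_i)$. Let $D$ be the symmetric trilinear form on $J$ with $D(X,X,X)=\det X$, put $\langle X,Y\rangle=\mathrm{Tr}(X\circ Y)$, and let $X\times Y$ be the element with $\langle X\times Y,Z\rangle=3D(X,Y,Z)$ for all $Z$. All of this extends to $k^{\mathrm s}$. Let $G_1=GE_6$ be the group of $g\in GL(J)$ with $\det(gX)=c(g)\det X$ for a scalar $c(g)\ne0$, let $G=G_1\times GL(2)$, and let $G$ act on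 $V=J\oplus J=J\otimes \mathrm{Aff}^2$ by $g(x_1,x_2)=(a\,g_1x_1+b\,g_1x_2,\ c\,g_1x_1+d\,g_1x_2)$ for $g=\left(g_1,\left(\begin{smallmatrix}a&b\\c&d\end{smallmatrix}\right)\right)$. Let $\Delta(x)$ be the discriminant of the binary cubic form $\det(x_1v_1+x_2v_2)$, let $V^{\mathrm{ss}}_k=\{x\in V_k:\Delta(x)\neq0\}$, and let $w=(\mathrm{diag}(1,-1,0),\mathrm{diag}(0,1,-1))$. For $g=(g_1,g_2)\in G$ put $\mu_g=c(g_1)\det(g_2)^2g_1$. For $v_1,\dots,v_8,X,Y\in J$ let $$\Psi_1(v_1\otimes\cdots\otimes v_8)(X,Y)=D(v_2,v_5,v_7)D(v_4,v_6,v_8)\,(v_1\times v_3)\times(X\times Y),$$ $$\Psi_2(v_1\otimes\cdots\otimes v_8)(X,Y)=D(v_2,v_5,v_7)D(v_4,v_6,v_8)\,\bigl(D(v_1,v_3,X)Y+D(v_1,v_3,Y)X\bigr),$$ and for $x=(x_1,x_2)\in V$ let $\Phi_{i,x}=\Psi_i\bigl((x_1\otimes x_2-x_2\otimes x_1)^{\otimes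 4}\bigr)$ and $$S_x=-18\,\Phi_{1,x}+\tfrac{27}{2}\,\Phi_{2,x}.$$ For $x\in V_k^{\mathrm{ss}}$ let $M_x$ be the space $J$ with the product $X\circ_xY=\Delta(x)^{-1}S_x(X,Y)$. An isotope of $J$ is an algebra isomorphic to $J^{(a)}$ for some $a\in J$ with $\det a\ne0$, where $J^{(a)}$ is the space $J$ with the product $X\circ(a\circ Y)+Y\circ(a\circ X)-a\circ(X\circ Y)$. Let $\mathrm{JIC}(k)$ be the set of equivalence classes of pairs $(M,n)$, where $M$ is an isotope of $J$ and $n\subset M$ is a cubic étale subalgebra containing the unit of $M$; two pairs are equivalent if an isomorphism of $k$-algebras between the first members carries the one second member onto the other. A pair $(M,n)$ *corresponds* to $x\in V_k^{\mathrm{ss}}$ if, for some $g\in G_{k^{\mathrm s}}$ with $x=gw$, it is isomorphic to the twisted form of $(J,\{\text{diagonal matrices}\})$ by the cocycle $\sigma\mapsto\mu_{g^{-1}\sigma(g)}$ of $\mathrm{Gal}(k^{\mathrm s}/k)$, that is, to the $k$-algebra $\{Z\in J_{k^{\mathrm s}}:\mu_{g^{-1}\sigma(g)}(\sigma Z)=Z\text{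 for all }\sigma\}$ with the product $\circ$, together with its subalgebra of diagonal matrices. **Theorem.** 1. $S_w(X,Y)=X\circ Y$, and $S_{gx}(g_1X,g_1Y)=c(g_1)^3\det(g_2)^4\,g_1\bigl(S_x(X,Y)\bigr)$ for all $g=(g_1,g_2)\in G_k$, $x\in V_k$ and $X,Y\in J$. For $x\in V_k^{\mathrm{ss}}$ and $g\in G_k$ one has $gx\in V_k^{\mathrm{ss}}$, and $\mu_g:M_x\to M_{gx}$ is an isomorphism of $k$-algebras. 2. If $h\in G_{k^{\mathrm s}}$ and $hw=w$, then $\mu_h$ is an automorphism of the algebra $J_{k^{\mathrm s}}$ that preserves the subalgebra of diagonal matrices. 3. Let $x\in V_k^{\mathrm{ss}}$. Then $M_x$ is a $k$-form of $J$, that is, $k^{\mathrm s}\otimes_kM_x\cong J_{k^{\mathrm s}}$, and $M_x$ is the algebra of the pair in $\mathrm{JIC}(k)$ that corresponds to $x$: there is a cubic étale subalgebra $n_x\subset M_x$ such that $(M_x,n_x)$ represents an element of $\mathrm{JIC}(k)$ and corresponds to $x$, and every pair $(M,n)$ that corresponds to $x$ is equivalent to $(M_x,n_x)$. In particular $M\cong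 M_x$ as $k$-algebras for every such pair. -/

import Mathlib

open scoped TensorProduct

universe u v w

namespace OctJordan

/-! ### Octonion algebras and the space of Hermitian matrices -/

section Space

/-- `C` (a unital, not necessarily associative `K`-algebra) with the norm `N` is an octonion
algebra: an eight-dimensional algebra whose norm is a nondegenerate quadratic form
permitting composition. -/
structure IsOctonion {K : Type u} {C : Type v} [Field K] [NonAssocRing C] [Module K C]
    [SMulCommClass K C C] [IsScalarTower K C C] (N : QuadraticForm K C) : Prop where
  finrank_eq : Module.finrank K C = 8
  nondegenerate : ∀ x : C, (∀ y : C, QuadraticMap.polar N x y = 0) → x = 0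
  norm_mul : ∀ x y : C, N (x * y) = N x * N y

/-- The space `J` of Hermitian `3 × 3` matrices over `C`. The element `X` with
`X.1 = (s₁, s₂, s₃)` and `X.2 = (x₁, x₂, x₃)` stands for the matrix
`(s₁, x₃, x̄₂ ; x̄₃, s₂, x₁ ; x₂, x̄₁, s₃)`. -/
abbrev J (K : Type u) (C : Type v) : Type (max u v) := (Fin 3 → K) × (Fin 3 → C)

/-- `V = J ⊗ Aff²`, as pairs of elements of `J`. -/
abbrev V (K : Type u) (C : Type v) : Type (max u v) := Fin 2 → J K C

/-! In the formulas below, `C` carries only the operations that they use; they are applied to an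
octonion algebra and to its extensions of scalars. -/

variable {K : Type u} {C : Type v} [Field K] [AddCommGroup C] [Module K C] [Mul C] [One C]


/-- The trace `tr x = x + x̄` of an octonion. -/
def otr (N : QuadraticForm K C) (x : C) : K := QuadraticMap.polar N x 1

/-- The conjugate `x̄` of an octonion. -/
def oconj (N : QuadraticForm K C) (x : C) : C := otr N x • (1 : C) - x

/-- The Hermitian matrix that an element of `J` stands for. -/
def toMatrix (N : QuadraticForm K C) (X : J K C) : Matrix (Fin 3) (Fin 3) C :=
  !![X.1 0 • 1, X.2 2, oconj N (X.2 1);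
     oconj N (X.2 2), X.1 1 • 1, X.2 0;
     X.2 1, oconj N (X.2 0), X.1 2 • 1]

/-- The Jordan product `X ∘ Y = (XY + YX) / 2`, entry by entry. -/
def jmul (N : QuadraticForm K C) (X Y : J K C) : J K C :=
  let s := X.1
  let x := X.2
  let t := Y.1
  let y := Y.2
  let b := oconj N
  (![s 0 * t 0 + (2 : K)⁻¹ * otr N (x 2 * b (y 2) + x 1 * b (y 1)),
     s 1 * t 1 + (2 : K)⁻¹ * otr N (x 2 * b (y 2) + x 0 * b (y 0)),
     s 2 * t 2 + (2 : K)⁻¹ * otr N (x 1 * b (y 1) + x 0 * b (y 0))],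
   ![(2 : K)⁻¹ • (b (x 2) * b (y 1) + s 1 • y 0 + t 2 • x 0
        + b (y 2) * b (x 1) + t 1 • x 0 + s 2 • y 0),
     (2 : K)⁻¹ • (s 0 • y 1 + b (y 0) * b (x 2) + t 2 • x 1
        + t 0 • x 1 + b (x 0) * b (y 2) + s 2 • y 1),
     (2 : K)⁻¹ • (s 0 • y 2 + t 1 • x 2 + b (x 1) * b (y 0)
        + t 0 • x 2 + s 1 • y 2 + b (y 1) * b (x 0))])

/-- The identity matrix `e`. -/
def je : J K C := (fun _ => 1, 0)

/-- The sum of the diagonal entries. -/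
def jtr (X : J K C) : K := ∑ i, X.1 i

/-- The cubic form `det` on `J`. -/
def jdet (N : QuadraticForm K C) (X : J K C) : K :=
  X.1 0 * X.1 1 * X.1 2 + otr N (X.2 0 * X.2 1 * X.2 2) - ∑ i, X.1 i * N (X.2 i)

/-- The symmetric trilinear form with `D(X, X, X) = det X`. -/
def jD (N : QuadraticForm K C) (X Y Z : J K C) : K :=
  (6 : K)⁻¹ * (jdet N (X + Y + Z) - jdet N (X + Y) - jdet N (Y + Z) - jdet N (Z + X)
    + jdet N X + jdet N Y + jdet N Z)

/-- The symmetric bilinear form `⟨X, Y⟩ = Tr (X ∘ Y)`. -/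
def jpair (N : QuadraticForm K C) (X Y : J K C) : K := jtr (jmul N X Y)

/-- The cross product: the element `X × Y` with `⟨X × Y, Z⟩ = 3 D(X, Y, Z)` for all `Z`. -/
noncomputable def jcross (N : QuadraticForm K C) (X Y : J K C) : J K C :=
  Classical.epsilon fun W => ∀ Z : J K C, jpair N W Z = 3 * jD N X Y Z

/-- The product `X ∘_a Y = X ∘ (a ∘ Y) + Y ∘ (a ∘ X) - a ∘ (X ∘ Y)` of the isotope
`J^{(a)}` of `J`. -/
def isotopeMul (N : QuadraticForm K C) (a X Y : J K C) : J K C :=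
  jmul N X (jmul N a Y) + jmul N Y (jmul N a X) - jmul N a (jmul N X Y)

/-! ### The prehomogeneous vector space `(G, V)` -/

/-- The group `GL(J) × GL(2)`, which contains `G`. -/
abbrev Amb (K : Type u) (C : Type v) [Field K] [AddCommGroup C] [Module K C] :
    Type (max u v) := (J K C ≃ₗ[K] J K C) × GL (Fin 2) K

/-- `GE₆`: the linear automorphisms of `J` that preserve `det` up to a scalar. -/
def GE6 (N : QuadraticForm K C) : Subgroup (J K C ≃ₗ[K] J K C) where
  carrier := {g | ∃ c : Kˣ, ∀ X, jdet N (g X) = c * jdet N X}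
  one_mem' := ⟨1, fun X => by simp⟩
  mul_mem' := by
    rintro g h ⟨c, hc⟩ ⟨d, hd⟩
    exact ⟨c * d, fun X => by rw [LinearEquiv.mul_apply, hc, hd]; push_cast; ring⟩
  inv_mem' := by
    rintro g ⟨c, hc⟩
    refine ⟨c⁻¹, fun X => ?_⟩
    have h := hc (g⁻¹ X)
    have h2 : g (g⁻¹ X) = X := g.apply_symm_apply X
    rw [h2] at h
    rw [h, Units.inv_mul_cancel_left]

/-- The group `G = GE₆ × GL(2)`. -/
def G (N : QuadraticForm K C) : Subgroup (Amb K C) := (GE6 N).prod ⊤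

/-- The multiplier `c(g₁)`; as `det e = 1`, it is `det (g₁ e)`. -/
def mult (N : QuadraticForm K C) (g₁ : J K C ≃ₗ[K] J K C) : K := jdet N (g₁ je)

/-- The action of `GL(J) × GL(2)` on `V`. -/
def act (g : Amb K C) (x : V K C) : V K C :=
  fun i => ∑ j, (g.2 : Matrix (Fin 2) (Fin 2) K) i j • g.1 (x j)

/-- `μ_g = c(g₁) det(g₂)² g₁`, as a map from `J` to `J`. -/
def mu (N : QuadraticForm K C) (g : Amb K C) (X : J K C) : J K C :=
  (mult N g.1 * (g.2 : Matrix (Fin 2) (Fin 2) K).det ^ 2) • g.1 X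

/-- The base point `w = (diag(1, -1, 0), diag(0, 1, -1))`. -/
def basePt : V K C := ![(![1, -1, 0], 0), (![0, 1, -1], 0)]

/-- The binary cubic form `F_x(v) = det(x₁ v₁ + x₂ v₂)`, through its four coefficients. -/
def binCubic (N : QuadraticForm K C) (x : V K C) : Cubic K where
  a := jdet N (x 0)
  b := 3 * jD N (x 0) (x 0) (x 1)
  c := 3 * jD N (x 0) (x 1) (x 1)
  d := jdet N (x 1)

/-- The relative invariant `Δ(x)` of degree `12`: the discriminant of `F_x`. -/
def Delta (N : QuadraticForm K C) (x : V K C) : K := (binCubic N x).discr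

/-! ### The equivariant map -/

/-- The factors `v₁, …, v₈` (numbered from `0`) of the term with index `ε` in the expansion of
`t₄(a, b) = (a ⊗ b - b ⊗ a)^{⊗ 4}`, for `(a, b) = (x 0, x 1)`: the `j`-th pair of factors is
`a ⊗ b` when `ε j = 0` and `b ⊗ a` when `ε j = 1`. -/
def t4 (x : V K C) (ε : Fin 4 → Fin 2) : Fin 8 → J K C :=
  ![x (ε 0), x (ε 0).rev, x (ε 1), x (ε 1).rev, x (ε 2), x (ε 2).rev, x (ε 3), x (ε 3).rev]

/-- The sign of the term with index `ε` in the expansion of `t₄`. -/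
def t4sign (ε : Fin 4 → Fin 2) : ℤ := ∏ j, (-1) ^ (ε j : ℕ)

/-- `Ψ₁(v₁ ⊗ ⋯ ⊗ v₈)(X, Y)`. -/
noncomputable def Psi1 (N : QuadraticForm K C) (v : Fin 8 → J K C) (X Y : J K C) : J K C :=
  (jD N (v 1) (v 4) (v 6) * jD N (v 3) (v 5) (v 7)) •
    jcross N (jcross N (v 0) (v 2)) (jcross N X Y)

/-- `Ψ₂(v₁ ⊗ ⋯ ⊗ v₈)(X, Y)`. -/
def Psi2 (N : QuadraticForm K C) (v : Fin 8 → J K C) (X Y : J K C) : J K C :=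
  (jD N (v 1) (v 4) (v 6) * jD N (v 3) (v 5) (v 7)) •
    (jD N (v 0) (v 2) X • Y + jD N (v 0) (v 2) Y • X)

/-- `Φ_{1,x}(X, Y) = Ψ₁(t₄(x))(X, Y)`. -/
noncomputable def Phi1 (N : QuadraticForm K C) (x : V K C) (X Y : J K C) : J K C :=
  ∑ ε : Fin 4 → Fin 2, t4sign ε • Psi1 N (t4 x ε) X Y

/-- `Φ_{2,x}(X, Y) = Ψ₂(t₄(x))(X, Y)`. -/
def Phi2 (N : QuadraticForm K C) (x : V K C) (X Y : J K C) : J K C :=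
  ∑ ε : Fin 4 → Fin 2, t4sign ε • Psi2 N (t4 x ε) X Y

/-- `S_x(X, Y)`, normalized so that `S_w(X, Y) = X ∘ Y`. -/
noncomputable def S (N : QuadraticForm K C) (x : V K C) (X Y : J K C) : J K C :=
  (-18 : K) • Phi1 N x X Y + (27 / 2 : K) • Phi2 N x X Y

/-- The product `X ∘_x Y = Δ(x)⁻¹ S_x(X, Y)` of the algebra `M_x` on the space `J`. -/
noncomputable def prodAt (N : QuadraticForm K C) (x : V K C) (X Y : J K C) : J K C :=
  (Delta N x)⁻¹ • S N x X Y

set_option linter.unusedSectionVars false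

open QuadraticMap in
theorem polar_oconj (N : QuadraticForm K C) (x y : C) :
    polar N (oconj N x) y = polar N x (oconj N y) := by
  simp only [oconj, otr, polar_sub_left, polar_sub_right, polar_smul_left, polar_smul_right,
    smul_eq_mul, polar_comm N 1 y]
  ring

theorem oconj_add (N : QuadraticForm K C) (x y : C) : oconj N (x + y) = oconj N x + oconj N y := by
  simp only [oconj, otr, QuadraticMap.polar_add_left, add_smul]
  abel

theorem oconj_smul (N : QuadraticForm K C) (a : K) (x : C) : oconj N (a • x) = a • oconj N x := by
  simp only [oconj, otr, QuadraticMap.polar_smul_left, smul_sub, smul_smul, smul_eq_mul]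

end Space

/-! The product `jmul` is the one given by matrix multiplication. -/

section JordanProduct

variable {K : Type u} {C : Type v} [Field K] [NonAssocRing C] [Module K C]
  [SMulCommClass K C C] [IsScalarTower K C C] {N : QuadraticForm K C}

open QuadraticMap in
theorem IsOctonion.norm_one (hN : IsOctonion N) : N 1 = 1 := by
  by_contra h
  have h0 : N 1 = 0 := by
    have h1 := hN.norm_mul 1 1
    rw [mul_one] at h1
    by_contra h2
    exact h (mul_left_cancel₀ h2 (by rw [mul_one]; exact h1.symm))
  have hz : ∀ x, N x = 0 := fun x => by
    have := hN.norm_mul x 1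
    rwa [h0, mul_zero, mul_one] at this
  have hx : ∀ x : C, x = 0 := fun x => hN.nondegenerate x fun y => by simp [polar, hz]
  have : Subsingleton C := ⟨fun a b => by rw [hx a, hx b]⟩
  have h8 := hN.finrank_eq
  rw [Module.finrank_zero_of_subsingleton] at h8
  omega

open QuadraticMap in
theorem IsOctonion.polar_mul_left (hN : IsOctonion N) (x z w : C) :
    polar N (x * z) w = polar N z (oconj N x * w) := by
  have h1 := hN.norm_mul (x + 1) (z + w)
  have h2 := hN.norm_mul x (z + w)
  have h3 := hN.norm_mul (x + 1) z
  have h4 := hN.norm_mul (x + 1) w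
  have e : ∀ a b, N (a + b) = N a + N b + polar N a b := fun a b => by
    simp only [polar]; ring
  simp only [add_mul, mul_add, one_mul] at h1 h2 h3 h4
  rw [e, e, e, e, polar_add_left, polar_add_right, polar_add_right] at h1
  simp only [e, hN.norm_mul, hN.norm_one] at h1 h2 h3 h4
  simp only [oconj, sub_mul, smul_mul_assoc, one_mul, polar_sub_right, polar_smul_right, otr,
    smul_eq_mul]
  rw [polar_comm N z (x * w)]
  simp only [polar_comm N z (x * w)] at h1 h2 h3 h4
  linear_combination h1 - h2 - h3 - h4

open QuadraticMap in
theorem IsOctonion.polar_mul_right (hN : IsOctonion N) (x z w : C) :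
    polar N (z * x) w = polar N z (w * oconj N x) := by
  have h1 := hN.norm_mul (z + w) (x + 1)
  have h2 := hN.norm_mul (z + w) x
  have h3 := hN.norm_mul z (x + 1)
  have h4 := hN.norm_mul w (x + 1)
  have e : ∀ a b, N (a + b) = N a + N b + polar N a b := fun a b => by
    simp only [polar]; ring
  simp only [add_mul, mul_add, mul_one] at h1 h2 h3 h4
  rw [e, e, e, e, polar_add_left, polar_add_right, polar_add_right] at h1
  simp only [e, hN.norm_mul, hN.norm_one] at h1 h2 h3 h4
  simp only [oconj, mul_sub, mul_smul_comm, mul_one, polar_sub_right, polar_smul_right, otr,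
    smul_eq_mul]
  rw [polar_comm N z (w * x)]
  linear_combination h1 - h2 - h3 - h4

open QuadraticMap in
theorem IsOctonion.oconj_oconj (hN : IsOctonion N) (x : C) : oconj N (oconj N x) = x := by
  have h : otr N (oconj N x) = otr N x := by
    have h1 : polar N (1 : C) 1 = 2 := by
      rw [polar_self, hN.norm_one]; norm_num
    simp only [oconj, otr, polar_sub_left, polar_smul_left, h1, smul_eq_mul]
    ring
  rw [oconj, h, oconj, sub_sub_cancel]

open QuadraticMap in
theorem IsOctonion.oconj_mul (hN : IsOctonion N) (x y : C) :
    oconj N (x * y) = oconj N y * oconj N x := by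
  refine sub_eq_zero.1 (hN.nondegenerate _ fun z => ?_)
  rw [polar_sub_left, polar_oconj, hN.polar_mul_left x y, hN.polar_mul_left (oconj N y),
    hN.oconj_oconj, polar_comm N (oconj N x), hN.polar_mul_right, sub_self]

theorem IsOctonion.mul_oconj_add (hN : IsOctonion N) (x y : C) :
    x * oconj N y + y * oconj N x = otr N (x * oconj N y) • (1 : C) := by
  have h := hN.oconj_mul x (oconj N y)
  rw [hN.oconj_oconj] at h
  rw [← h]
  exact add_sub_cancel _ _

theorem IsOctonion.oconj_mul_add (hN : IsOctonion N) (x y : C) :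
    oconj N x * y + oconj N y * x = otr N (x * oconj N y) • (1 : C) := by
  have h := hN.mul_oconj_add (oconj N x) (oconj N y)
  rw [hN.oconj_oconj, hN.oconj_oconj] at h
  rw [h, otr, otr, hN.polar_mul_right, hN.polar_mul_right, one_mul, one_mul, polar_oconj]

/-- `jmul` is the product `(XY + YX) / 2` of Hermitian matrices. -/
theorem IsOctonion.toMatrix_jmul (hN : IsOctonion N) (h2 : (2 : K) ≠ 0) (X Y : J K C) :
    toMatrix N (jmul N X Y) =
      (2 : K)⁻¹ • (toMatrix N X * toMatrix N Y + toMatrix N Y * toMatrix N X) := by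
  have ht : ∀ x y : C, otr N (x + y) = otr N x + otr N y := fun x y =>
    QuadraticMap.polar_add_left N x y 1
  have hh : ∀ s t : K, s * t = (2 : K)⁻¹ * (s * t + t * s) := fun s t => by
    field_simp; ring
  ext i j
  have hs : ∀ s t : K, (s * t) • (1 : C) = ((2 : K)⁻¹ * (s * t + t * s)) • (1 : C) :=
    fun s t => by rw [← hh]
  have p := fun i => hN.mul_oconj_add (X.2 i) (Y.2 i)
  have q := fun i => hN.oconj_mul_add (X.2 i) (Y.2 i)
  fin_cases i <;> fin_cases j <;>
    simp [toMatrix, jmul, oconj_add, oconj_smul, ht,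
      hN.oconj_mul, hN.oconj_oconj, smul_smul]
  · linear_combination (norm := module) hs (X.1 0) (Y.1 0) - (2 : K)⁻¹ • p 2 - (2 : K)⁻¹ • q 1
  · module
  · module
  · module
  · linear_combination (norm := module) hs (X.1 1) (Y.1 1) - (2 : K)⁻¹ • q 2 - (2 : K)⁻¹ • p 0
  · module
  · module
  · module
  · linear_combination (norm := module) hs (X.1 2) (Y.1 2) - (2 : K)⁻¹ • p 1 - (2 : K)⁻¹ • q 0

end JordanProduct

/-! ### Extension of scalars and the Galois action -/

section Galois

variable {k : Type u} {C : Type v} [Field k] [AddCommGroup C] [Module k C] (L : Type u) [Field L] [Algebra k L]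

/-- The inclusion of `J` in `J_L`. -/
def baseJ (X : J k C) : J L (L ⊗[k] C) :=
  (fun i => algebraMap k L (X.1 i), fun i => (1 : L) ⊗ₜ[k] X.2 i)

/-- The inclusion of `V` in `V_L`. -/
def baseV (x : V k C) : V L (L ⊗[k] C) := fun i => baseJ L (x i)

variable {L}

/-- The action of `σ` on `L ⊗ C`. -/
noncomputable def galC (σ : L ≃ₐ[k] L) : L ⊗[k] C →ₗ[k] L ⊗[k] C :=
  σ.toLinearMap.rTensor C

theorem galC_smul (σ : L ≃ₐ[k] L) (a : L) (z : L ⊗[k] C) :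
    galC σ (a • z) = σ a • galC σ z := by
  induction z using TensorProduct.induction_on with
  | zero => simp
  | tmul b c => simp [galC, TensorProduct.smul_tmul']
  | add z₁ z₂ h₁ h₂ => rw [smul_add, map_add, h₁, h₂, map_add, smul_add]

theorem galC_galC (σ τ : L ≃ₐ[k] L) (h : ∀ a, σ (τ a) = a) (z : L ⊗[k] C) :
    galC σ (galC τ z) = z := by
  induction z using TensorProduct.induction_on with
  | zero => simp
  | tmul b c => simp [galC, h]
  | add z₁ z₂ h₁ h₂ => rw [map_add, map_add, h₁, h₂]

/-- The action of `σ` on `J_L`, entry by entry. -/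
noncomputable def galJ (σ : L ≃ₐ[k] L) (X : J L (L ⊗[k] C)) : J L (L ⊗[k] C) :=
  (fun i => σ (X.1 i), fun i => galC σ (X.2 i))

theorem galJ_add (σ : L ≃ₐ[k] L) (X Y : J L (L ⊗[k] C)) :
    galJ σ (X + Y) = galJ σ X + galJ σ Y := by
  ext i <;> simp [galJ]

theorem galJ_smul (σ : L ≃ₐ[k] L) (a : L) (X : J L (L ⊗[k] C)) :
    galJ σ (a • X) = σ a • galJ σ X := by
  ext i <;> simp [galJ, galC_smul]

theorem galJ_galJ (σ τ : L ≃ₐ[k] L) (h : ∀ a, σ (τ a) = a) (X : J L (L ⊗[k] C)) :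
    galJ σ (galJ τ X) = X := by
  ext i <;> simp [galJ, galC_galC σ τ h, h]

/-- The action `g ↦ σ ∘ g ∘ σ⁻¹` of `σ` on `GL(J_L)`. -/
noncomputable def galGL (σ : L ≃ₐ[k] L) (g : J L (L ⊗[k] C) ≃ₗ[L] J L (L ⊗[k] C)) :
    J L (L ⊗[k] C) ≃ₗ[L] J L (L ⊗[k] C) where
  toFun X := galJ σ (g (galJ σ.symm X))
  invFun X := galJ σ (g.symm (galJ σ.symm X))
  map_add' X Y := by simp only [galJ_add, map_add]
  map_smul' a X := by
    simp only [galJ_smul, map_smul, AlgEquiv.apply_symm_apply, RingHom.id_apply]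
  left_inv X := by
    simp only [galJ_galJ σ.symm σ σ.symm_apply_apply, LinearEquiv.symm_apply_apply,
      galJ_galJ σ σ.symm σ.apply_symm_apply]
  right_inv X := by
    simp only [galJ_galJ σ.symm σ σ.symm_apply_apply, LinearEquiv.apply_symm_apply,
      galJ_galJ σ σ.symm σ.apply_symm_apply]

/-- The action of `σ` on `GL(J_L) × GL(2)_L`. -/
noncomputable def galAmb (σ : L ≃ₐ[k] L) (g : Amb L (L ⊗[k] C)) : Amb L (L ⊗[k] C) :=
  (galGL σ g.1, Matrix.GeneralLinearGroup.map (σ : L →+* L) g.2)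

end Galois

/-! ### Pairs of an algebra and a cubic étale subalgebra -/

section Pairs

variable {k : Type u} {C : Type v} {M : Type w} {M' : Type*}
  [Field k] [NonAssocRing C] [Module k C]
  [AddCommGroup M] [Module k M] [AddCommGroup M'] [Module k M']

/-- The algebras `(M, m)` and `(M', m')` are isomorphic over `k`. -/
def AlgIso (k : Type u) [Field k] [Module k M] [Module k M']
    (m : M → M → M) (m' : M' → M' → M') : Prop :=
  ∃ f : M ≃ₗ[k] M', ∀ X Y, f (m X Y) = m' (f X) (f Y)

/-- The pairs `(M, n)` and `(M', n')` are equivalent: some isomorphism of `k`-algebras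
`M → M'` carries `n` onto `n'`. -/
def PairEquiv (m : M → M → M) (n : Submodule k M) (m' : M' → M' → M')
    (n' : Submodule k M') : Prop :=
  ∃ f : M ≃ₗ[k] M', (∀ X Y, f (m X Y) = m' (f X) (f Y)) ∧ ∀ X, X ∈ n ↔ f X ∈ n'

/-- `n` is a cubic étale subalgebra of the unital algebra `(M, m)`. -/
def IsCubicEtale (m : M → M → M) (n : Submodule k M) : Prop :=
  ∃ (E : Type u) (_ : CommRing E) (_ : Algebra k E),
    Algebra.Etale k E ∧ Module.finrank k E = 3 ∧
    ∃ ι : E →ₗ[k] M, Function.Injective ι ∧ LinearMap.range ι = n ∧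
      (∀ a b, ι (a * b) = m (ι a) (ι b)) ∧ ∀ X, m (ι 1) X = X ∧ m X (ι 1) = X

/-- The pair `(M, n)` represents an element of `JIC(k)`: `M` is (isomorphic to) an isotope of
`J` and `n` is a cubic étale subalgebra of `M`. -/
structure IsJIC (N : QuadraticForm k C) (m : M → M → M) (n : Submodule k M) : Prop where
  isotope : ∃ a : J k C, jdet N a ≠ 0 ∧ AlgIso k m (isotopeMul N a)
  cubicEtale : IsCubicEtale m n

variable [SMulCommClass k C C] [IsScalarTower k C C] [Invertible (2 : k)]
  (L : Type u) [Field L] [Algebra k L]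

/-- The norm of the octonion algebra `L ⊗ C` over `L`. -/
noncomputable abbrev extNorm (N : QuadraticForm k C) : QuadraticForm L (L ⊗[k] C) :=
  QuadraticForm.baseChange L N

/-- The algebra `(M, m)` is a `k`-form of `J`: after extension of scalars to `L` (a separable
closure of `k`), it is isomorphic to `J_L`. -/
def IsForm (N : QuadraticForm k C) (m : M → M → M) : Prop :=
  ∃ φ : M →ₗ[k] J L (L ⊗[k] C),
    IsBaseChange L φ ∧ ∀ X Y, φ (m X Y) = jmul (extNorm L N) (φ X) (φ Y)

/-- The pair `(M, n)` corresponds to `x`: for some `g` in `G` over the separable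
closure `L` of `k` with `x = g w`,
the pair is isomorphic to the twisted form of `(J, diagonal matrices)` by the cocycle
`σ ↦ μ(g⁻¹ σ(g))`, that is, to the algebra of all `Z` in `J_L` with
`μ(g⁻¹ σ(g)) (σ Z) = Z` for all `σ`, together with its subspace of diagonal matrices. -/
def Corresponds (N : QuadraticForm k C) (x : V k C) (m : M → M → M) (n : Submodule k M) :
    Prop :=
  ∃ g ∈ G (extNorm L N), act g basePt = baseV L x ∧
    ∃ φ : M →ₗ[k] J L (L ⊗[k] C),
      Function.Injective φ ∧
      (∀ Z, Z ∈ LinearMap.range φ ↔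
        ∀ σ : L ≃ₐ[k] L,
          mu (extNorm L N) (g⁻¹ * galAmb σ g) (galJ σ Z) = Z) ∧
      (∀ X Y, φ (m X Y) = jmul (extNorm L N) (φ X) (φ Y)) ∧
      ∀ X, X ∈ n ↔ (φ X).2 = 0

end Pairs

end OctJordan

open OctJordan

set_option linter.unusedSectionVars false

/-! The product $S_x$ is, up to a constant, the product of an isotope of $J$. Contracting
$(x_1\otimes x_2-x_2\otimes x_1)^{\otimes4}$ with the two factors $D$ leaves a single covariant
$h_x\in J$ (`hess`), built from the Hessian of the binary cubic form and the elements $x_i\times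
x_j$. The polarized cubic equation of $J$ rewrites the product of $J^{(a)}$ as $\frac12(\langle
a,X\rangle Y+\langle a,Y\rangle X)-2\,a\times(X\times Y)$ (`IsOctonion.isotopeMul_eq`), so that
$S_x$ is $9$ times the product of $J^{(h_x)}$ (`IsOctonion.S_eq`). At the base point $h_w=\frac19e$,
which gives $S_w=\circ$.

Equivariance rests on duality. Let $g'$ be the contragredient of $g\in GE_6$ for the trace form.
Invariance of $D$ gives $gX\times gY=c(g)\,g'(X\times Y)$, and the adjoint identity
$(X^\#)^\#=\det(X)X$, where $X^\#=X\times X$, gives the converse rule $g'X\times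
g'Y=c(g)^{-1}g(X\times Y)$ (`IsOctonion.cross_dual`). Together with $h_{gx}=c^3\det(g_2)^4\,g_1'h_x$
they yield the formula for $S_{gx}$. As $\Delta$ is multiplied by $c^4\det(g_2)^6$, the scalar in
$\mu_g$ is exactly the one that makes $\mu_g$ multiplicative.

Over the separable closure $G$ is transitive on semistable points (`IsOctonion.exists_act_basePt`):
the binary cubic form acquires three distinct roots, the adjoints of the corresponding singular
elements have rank one, and transvections bring them to the diagonal.

The rest is descent. If $x=gw$, then $\mu_g^{-1}$ embeds $M_x$ in $J_{k^{\mathrm s}}$, and its image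
is the fixed set of the twisted Galois action. The subalgebra $n_x$ is the preimage of the diagonal
matrices; it contains the unit of $M_x$ and $x_1,x_2$, which over $k^{\mathrm s}$ span the diagonal,
so it is cubic étale. Another choice of $g$ differs by the stabilizer of $w$, which preserves the
diagonal; hence the pair is unique up to equivalence. -/

namespace OctJordan

/-! ### Identities of composition algebras. -/

section OctonionIdentities

open QuadraticMap

variable {K : Type u} {C : Type v} [Field K] [NonAssocRing C] [Module K C]
  [SMulCommClass K C C] [IsScalarTower K C C] {N : QuadraticForm K C}

theorem map_add_eq (N : QuadraticForm K C) (x y : C) :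
    N (x + y) = N x + N y + polar N x y := by
  simp only [polar]; ring

theorem otr_add (N : QuadraticForm K C) (x y : C) : otr N (x + y) = otr N x + otr N y :=
  polar_add_left N x y 1

theorem otr_smul (N : QuadraticForm K C) (a : K) (x : C) : otr N (a • x) = a * otr N x :=
  polar_smul_left N a x 1

theorem otr_sub (N : QuadraticForm K C) (x y : C) : otr N (x - y) = otr N x - otr N y :=
  polar_sub_left N x y 1

theorem oconj_sub (N : QuadraticForm K C) (x y : C) :
    oconj N (x - y) = oconj N x - oconj N y := by
  simp only [oconj, otr, polar_sub_left, sub_smul]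
  abel

theorem IsOctonion.otr_mul (hN : IsOctonion N) (x y : C) :
    otr N (x * y) = polar N x (oconj N y) := by
  rw [otr, hN.polar_mul_right, one_mul]

theorem IsOctonion.otr_mul_comm (hN : IsOctonion N) (x y : C) :
    otr N (x * y) = otr N (y * x) := by
  rw [hN.otr_mul, hN.otr_mul, ← polar_oconj, polar_comm]

theorem IsOctonion.otr_mul_assoc (hN : IsOctonion N) (x y z : C) :
    otr N (x * y * z) = otr N (x * (y * z)) := by
  rw [hN.otr_mul, hN.otr_mul, hN.polar_mul_right, hN.oconj_mul]

theorem IsOctonion.otr_mul_rotate (hN : IsOctonion N) (x y z : C) :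
    otr N (x * y * z) = otr N (y * z * x) := by
  rw [hN.otr_mul_assoc, hN.otr_mul_comm]

theorem IsOctonion.polar_oconj_mul (hN : IsOctonion N) (x y z : C) :
    polar N (oconj N (x * y)) z = otr N (x * y * z) := by
  rw [hN.otr_mul, polar_oconj]

theorem IsOctonion.polar_mul_same (hN : IsOctonion N) (x y z : C) :
    polar N (x * y) (x * z) = N x * polar N y z := by
  simp only [polar, ← mul_add, hN.norm_mul]; ring

theorem IsOctonion.oconj_mul_mul (hN : IsOctonion N) (x y : C) :
    oconj N x * (x * y) = N x • y := by
  refine sub_eq_zero.1 (hN.nondegenerate _ fun z => ?_)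
  rw [polar_sub_left, polar_comm, ← hN.polar_mul_left, hN.polar_mul_same, polar_smul_left,
    polar_comm N z, smul_eq_mul, sub_self]

theorem IsOctonion.norm_oconj (hN : IsOctonion N) (x : C) : N (oconj N x) = N x := by
  have h : polar N (1 : C) 1 = 2 := by rw [polar_self, hN.norm_one]; norm_num
  have e : oconj N x = otr N x • (1 : C) + (-1 : K) • x := by simp [oconj, sub_eq_add_neg]
  rw [e, map_add_eq, polar_smul_left, polar_smul_right, QuadraticMap.map_smul,
    QuadraticMap.map_smul, hN.norm_one, polar_comm, ← otr]
  simp only [smul_eq_mul]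
  ring

theorem IsOctonion.mul_oconj_mul (hN : IsOctonion N) (x y : C) :
    x * (oconj N x * y) = N x • y := by
  have h := hN.oconj_mul_mul (oconj N x) y
  rwa [hN.oconj_oconj, hN.norm_oconj] at h

theorem IsOctonion.mul_mul_oconj (hN : IsOctonion N) (x y : C) :
    y * x * oconj N x = N x • y := by
  have h := congrArg (oconj N) (hN.mul_oconj_mul x (oconj N y))
  rwa [hN.oconj_mul, hN.oconj_mul, oconj_smul, hN.oconj_oconj, hN.oconj_oconj] at h

/-- The norm composition law, linearized in both factors. Being linear in each of its four
variables, it is also the form in which the law passes to extensions of scalars. -/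
theorem IsOctonion.polar_mul_mul (hN : IsOctonion N) (x y z w : C) :
    polar N (x * y) (z * w) + polar N (x * w) (z * y) = polar N x z * polar N y w := by
  have h := hN.polar_mul_same (x + z) y w
  simp only [add_mul, polar_add_left, polar_add_right, map_add_eq, hN.polar_mul_same] at h
  linear_combination h + polar_comm N (x * w) (z * y)

/-- The middle Moufang identity, with `x a x` expressed through the norm. -/
theorem IsOctonion.moufang (hN : IsOctonion N) (x y z : C) :
    (x * y) * (z * x) = otr N (x * (y * z)) • x - N x • oconj N (y * z) := by
  refine sub_eq_zero.1 (hN.nondegenerate _ fun w => ?_)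
  rw [polar_sub_left, polar_sub_left, polar_smul_left, polar_smul_left, hN.polar_mul_right,
    hN.oconj_mul z x]
  have h := hN.polar_mul_mul x y w (oconj N x * oconj N z)
  rw [hN.mul_oconj_mul, polar_smul_left] at h
  have h1 : polar N y (oconj N x * oconj N z) = otr N (x * (y * z)) := by
    rw [← hN.polar_mul_left, ← hN.otr_mul, hN.otr_mul_assoc]
  have h2 : polar N (oconj N z) (w * y) = polar N (oconj N (y * z)) w := by
    rw [hN.oconj_mul, hN.polar_mul_right, hN.oconj_oconj]
  rw [h1, h2] at h
  simp only [smul_eq_mul] at h ⊢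
  linear_combination h

end OctonionIdentities

/-! ### The trace form, the cross product and the adjoint identity. -/

section Cross

open QuadraticMap

variable {K : Type u} {C : Type v} [Field K] [NonAssocRing C] [Module K C]
  [SMulCommClass K C C] [IsScalarTower K C C]

/-- The trace form of `J` as a bilinear form. -/
def pairForm (N : QuadraticForm K C) : LinearMap.BilinForm K (J K C) :=
  LinearMap.mk₂ K (fun X Y => ∑ i, X.1 i * Y.1 i + ∑ i, polar N (X.2 i) (Y.2 i))
    (fun X X' Y => by simp [Fin.sum_univ_three]; ring)
    (fun a X Y => by simp [Fin.sum_univ_three]; ring)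
    (fun X Y Y' => by simp [Fin.sum_univ_three]; ring)
    (fun a X Y => by simp [Fin.sum_univ_three]; ring)

/-- The cross product as a bilinear map. -/
def cross (N : QuadraticForm K C) : J K C →ₗ[K] J K C →ₗ[K] J K C :=
  LinearMap.mk₂ K (fun X Y =>
    (fun i => (2 : K)⁻¹ * (X.1 (i + 1) * Y.1 (i + 2) + Y.1 (i + 1) * X.1 (i + 2)
        - polar N (X.2 i) (Y.2 i)),
     fun i => (2 : K)⁻¹ • (oconj N (X.2 (i + 1) * Y.2 (i + 2) + Y.2 (i + 1) * X.2 (i + 2))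
        - X.1 i • Y.2 i - Y.1 i • X.2 i)))
    (fun X X' Y => by
      ext i
      · simp; ring
      · simp [oconj_add, add_mul, mul_add]; module)
    (fun a X Y => by
      ext i
      · simp only [Prod.smul_fst, Pi.smul_apply, smul_eq_mul, Prod.smul_snd, polar_smul_left]
        ring
      · simp only [Prod.smul_fst, Pi.smul_apply, smul_eq_mul, Prod.smul_snd, oconj_add,
          oconj_smul, smul_mul_assoc, mul_smul_comm]
        module)
    (fun X Y Y' => by
      ext i
      · simp; ring
      · simp [oconj_add, add_mul, mul_add]; module)
    (fun a X Y => by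
      ext i
      · simp only [Prod.smul_fst, Pi.smul_apply, smul_eq_mul, Prod.smul_snd, polar_smul_right]
        ring
      · simp only [Prod.smul_fst, Pi.smul_apply, smul_eq_mul, Prod.smul_snd, oconj_add,
          oconj_smul, smul_mul_assoc, mul_smul_comm]
        module)

theorem pairForm_apply (N : QuadraticForm K C) (X Y : J K C) :
    pairForm N X Y = ∑ i, X.1 i * Y.1 i + ∑ i, polar N (X.2 i) (Y.2 i) := rfl

theorem cross_fst (N : QuadraticForm K C) (X Y : J K C) (i : Fin 3) :
    (cross N X Y).1 i = (2 : K)⁻¹ * (X.1 (i + 1) * Y.1 (i + 2) + Y.1 (i + 1) * X.1 (i + 2)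
        - polar N (X.2 i) (Y.2 i)) := rfl

theorem cross_snd (N : QuadraticForm K C) (X Y : J K C) (i : Fin 3) :
    (cross N X Y).2 i =
      (2 : K)⁻¹ • (oconj N (X.2 (i + 1) * Y.2 (i + 2) + Y.2 (i + 1) * X.2 (i + 2))
        - X.1 i • Y.2 i - Y.1 i • X.2 i) := rfl

theorem pairForm_comm (N : QuadraticForm K C) (X Y : J K C) :
    pairForm N X Y = pairForm N Y X := by
  simp only [pairForm_apply, polar_comm N (X.2 _), mul_comm (X.1 _)]

theorem cross_comm (N : QuadraticForm K C) (X Y : J K C) : cross N X Y = cross N Y X := by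
  ext i
  · rw [cross_fst, cross_fst, polar_comm]; ring
  · rw [cross_snd, cross_snd, add_comm]; module

variable {N : QuadraticForm K C}

theorem IsOctonion.pairForm_nondegenerate (hN : IsOctonion N) {X : J K C}
    (h : ∀ Z, pairForm N X Z = 0) : X = 0 := by
  ext i
  · have := h (Pi.single i 1, 0)
    simpa [pairForm_apply, Pi.single_apply] using this
  · refine hN.nondegenerate _ fun y => ?_
    have := h (0, Pi.single i y)
    rw [pairForm_apply] at this
    fin_cases i <;> simpa [Fin.sum_univ_three, Pi.single_apply] using this

theorem IsOctonion.ext_pairForm (hN : IsOctonion N) {X Y : J K C}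
    (h : ∀ Z, pairForm N X Z = pairForm N Y Z) : X = Y :=
  sub_eq_zero.1 <| hN.pairForm_nondegenerate fun Z => by
    rw [map_sub, LinearMap.sub_apply, h, sub_self]

theorem IsOctonion.jpair_eq (hN : IsOctonion N) (h2 : (2 : K) ≠ 0) (X Y : J K C) :
    jpair N X Y = pairForm N X Y := by
  simp [jpair, jtr, jmul, pairForm_apply, Fin.sum_univ_three, otr_add, hN.otr_mul,
    hN.oconj_oconj]
  field_simp
  ring

theorem IsOctonion.three_jD (hN : IsOctonion N) (h2 : (2 : K) ≠ 0) (h3 : (3 : K) ≠ 0)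
    (X Y Z : J K C) : 3 * jD N X Y Z = pairForm N (cross N X Y) Z := by
  have h6 : (6 : K) ≠ 0 := by
    rw [show (6 : K) = 2 * 3 by norm_num]; exact mul_ne_zero h2 h3
  have r := hN.otr_mul_rotate
  simp [jD, jdet, pairForm_apply, cross_fst, cross_snd, Fin.sum_univ_three, oconj_add,
    map_add_eq, hN.polar_oconj_mul, add_mul, mul_add, otr_add]
  rw [← r (Z.2 0) (X.2 1) (Y.2 2), ← r (Z.2 0) (Y.2 1) (X.2 2), r (X.2 2) (Y.2 0),
    r (Y.2 2) (X.2 0)]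
  simp only [polar_comm N (Z.2 _) (X.2 _)]
  field_simp
  ring

theorem jdet_smul (N : QuadraticForm K C) (a : K) (X : J K C) :
    jdet N (a • X) = a ^ 3 * jdet N X := by
  simp only [jdet, Fin.sum_univ_three, QuadraticMap.map_smul, Prod.smul_fst, Prod.smul_snd,
    Pi.smul_apply, smul_eq_mul, smul_mul_assoc, mul_smul_comm, otr_smul]
  ring

theorem IsOctonion.pairForm_cross_self (hN : IsOctonion N) (h2 : (2 : K) ≠ 0)
    (h3 : (3 : K) ≠ 0) (X : J K C) : pairForm N (cross N X X) X = 3 * jdet N X := by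
  have h6 : (6 : K) ≠ 0 := by
    rw [show (6 : K) = 2 * 3 by norm_num]; exact mul_ne_zero h2 h3
  rw [← hN.three_jD h2 h3, jD, show X + X + X = (3 : K) • X by module,
    show X + X = (2 : K) • X by module, jdet_smul, jdet_smul]
  field_simp
  ring

/-- The trace form is nondegenerate, so the defining property of $X\times Y$ has one solution, and
the explicit formula is one. -/
theorem IsOctonion.jcross_eq (hN : IsOctonion N) (h2 : (2 : K) ≠ 0) (h3 : (3 : K) ≠ 0)
    (X Y : J K C) : jcross N X Y = cross N X Y := by
  have h : ∀ Z, jpair N (jcross N X Y) Z = 3 * jD N X Y Z :=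
    Classical.epsilon_spec (p := fun W => ∀ Z : J K C, jpair N W Z = 3 * jD N X Y Z)
      ⟨cross N X Y, fun Z => by rw [hN.jpair_eq h2, hN.three_jD h2 h3]⟩
  refine hN.ext_pairForm fun Z => ?_
  rw [← hN.jpair_eq h2, h, hN.three_jD h2 h3]

theorem IsOctonion.jD_eq (hN : IsOctonion N) (h2 : (2 : K) ≠ 0) (h3 : (3 : K) ≠ 0)
    (X Y Z : J K C) : jD N X Y Z = 3⁻¹ * pairForm N (cross N X Y) Z := by
  rw [← hN.three_jD h2 h3, inv_mul_cancel_left₀ h3]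

/-- The trilinear form is symmetric. -/
theorem IsOctonion.pairForm_cross_right (hN : IsOctonion N) (h2 : (2 : K) ≠ 0)
    (h3 : (3 : K) ≠ 0) (X Y Z : J K C) :
    pairForm N (cross N X Y) Z = pairForm N X (cross N Y Z) := by
  rw [pairForm_comm N X, ← hN.three_jD h2 h3, ← hN.three_jD h2 h3, jD, jD,
    show Y + Z + X = X + Y + Z by abel]
  ring

/-- The trace of a triple product is cyclic and associative, so $\det$ can be read from any index;
later computations then treat one index instead of three. -/
theorem IsOctonion.jdet_eq (hN : IsOctonion N) (X : J K C) (i : Fin 3) :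
    jdet N X = X.1 i * X.1 (i + 1) * X.1 (i + 2)
      + otr N (X.2 i * (X.2 (i + 1) * X.2 (i + 2))) - X.1 i * N (X.2 i)
      - X.1 (i + 1) * N (X.2 (i + 1)) - X.1 (i + 2) * N (X.2 (i + 2)) := by
  rw [← hN.otr_mul_assoc]
  have r := hN.otr_mul_rotate
  fin_cases i <;> simp [jdet, Fin.sum_univ_three]
  · ring
  · rw [← r (X.2 0)]; ring
  · rw [r (X.2 2)]; ring

/-- The adjoint identity `(X^#)^# = det(X) X`. -/
theorem IsOctonion.cross_cross_self (hN : IsOctonion N) (h2 : (2 : K) ≠ 0) (X : J K C) :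
    cross N (cross N X X) (cross N X X) = jdet N X • X := by
  have hs : ∀ Y : J K C, ∀ i, (cross N Y Y).1 i =
      Y.1 (i + 1) * Y.1 (i + 2) - N (Y.2 i) := fun Y i => by
    rw [cross_fst, polar_self]; field_simp; ring
  have hx : ∀ Y : J K C, ∀ i, (cross N Y Y).2 i =
      oconj N (Y.2 (i + 1) * Y.2 (i + 2)) - Y.1 i • Y.2 i := fun Y i => by
    rw [cross_snd, oconj_add]
    match_scalars <;> field_simp <;> ring
  have hd := hN.jdet_eq X
  have i3 : ∀ i : Fin 3, i + 1 + 1 = i + 2 ∧ i + 1 + 2 = i ∧ i + 2 + 1 = i ∧ i + 2 + 2 = i + 1 := by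
    decide
  have hn : ∀ x y : C, N (x - y) = N x + N y - polar N x y := fun x y => by
    rw [sub_eq_add_neg, map_add_eq, polar_neg_right, QuadraticMap.map_neg]; ring
  ext i
  · obtain ⟨e1, e2, e3, e4⟩ := i3 i
    rw [hs, hs, hs, hx, e1, e2, e3, e4, hn, hN.norm_oconj, hN.norm_mul, QuadraticMap.map_smul,
      polar_smul_right, hN.polar_oconj_mul, hN.otr_mul_comm]
    rw [Prod.smul_fst, Pi.smul_apply, hd i]
    simp only [smul_eq_mul]
    ring
  · obtain ⟨e1, e2, e3, e4⟩ := i3 i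
    -- The off-diagonal entry contains a product of the shape $(xy)(zx)$; the Moufang identity
    -- evaluates it, and the remaining products collapse through $\bar x(xy)=N(x)y$ and its mirror
    -- image.
    rw [hx, hx, hx, hx, hs, e1, e2, e3, e4, hN.oconj_mul, oconj_sub, oconj_sub, hN.oconj_oconj,
      hN.oconj_oconj, oconj_smul, oconj_smul, sub_mul, mul_sub, mul_sub, hN.moufang,
      smul_mul_assoc, mul_smul_comm, smul_mul_assoc, mul_smul_comm, hN.mul_mul_oconj,
      hN.oconj_mul_mul, ← hN.oconj_mul]
    rw [Prod.smul_snd, Pi.smul_apply, hd i]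
    module

end Cross

/-! ### The Jordan product and the product of an isotope through the cross product. -/

section Isotope

open QuadraticMap

variable {K : Type u} {C : Type v} [Field K] [NonAssocRing C] [Module K C]
  [SMulCommClass K C C] [IsScalarTower K C C] {N : QuadraticForm K C}

theorem pairForm_je (N : QuadraticForm K C) (X : J K C) :
    pairForm N X je = ∑ i, X.1 i := by
  simp [pairForm_apply, je]

theorem pairForm_je_je (N : QuadraticForm K C) : pairForm N (je : J K C) je = 3 := by
  simp [pairForm_apply, je]

/-- The Jordan product in terms of the cross product. -/
theorem IsOctonion.jmul_eq (hN : IsOctonion N) (h2 : (2 : K) ≠ 0) (X Y : J K C) :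
    jmul N X Y = cross N X Y
      + (2 : K)⁻¹ • (pairForm N X je • Y + pairForm N Y je • X)
      - ((2 : K)⁻¹ * (pairForm N X je * pairForm N Y je - pairForm N X Y)) • je := by
  have e1 : (1 : Fin 3) + 2 = 0 := rfl
  have e2 : (2 : Fin 3) + 2 = 1 := rfl
  have e3 : (2 : Fin 3) + 1 = 0 := rfl
  rw [pairForm_je, pairForm_je, pairForm_apply]
  ext i
  · fin_cases i <;>
      simp [jmul, cross_fst, je, Fin.sum_univ_three, otr_add, hN.otr_mul, hN.oconj_oconj,
        e1, e2, e3] <;> field_simp <;> ring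
  · fin_cases i <;>
      simp [jmul, cross_snd, je, Fin.sum_univ_three, oconj_add, hN.oconj_mul,
        e1, e2, e3] <;> module

theorem cross_self_fst (N : QuadraticForm K C) (h2 : (2 : K) ≠ 0) (X : J K C)
    (i : Fin 3) : (cross N X X).1 i = X.1 (i + 1) * X.1 (i + 2) - N (X.2 i) := by
  rw [cross_fst, polar_self]; field_simp; ring

theorem cross_self_snd (N : QuadraticForm K C) (h2 : (2 : K) ≠ 0) (X : J K C)
    (i : Fin 3) :
    (cross N X X).2 i = oconj N (X.2 (i + 1) * X.2 (i + 2)) - X.1 i • X.2 i := by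
  rw [cross_snd, oconj_add]
  match_scalars <;> field_simp <;> ring

/-- This is the generic cubic equation of $J$ in disguise; off the diagonal it only needs $\bar
x(xy)=N(x)y$ and $(yx)\bar x=N(x)y$. -/
theorem IsOctonion.jmul_cross_self (hN : IsOctonion N) (h2 : (2 : K) ≠ 0) (X : J K C) :
    jmul N X (cross N X X) = jdet N X • je := by
  have e1 : (1 : Fin 3) + 2 = 0 := rfl
  have e2 : (2 : Fin 3) + 2 = 1 := rfl
  have e3 : (2 : Fin 3) + 1 = 0 := rfl
  have r := hN.otr_mul_rotate
  ext i
  · fin_cases i <;>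
    simp [jmul, je, jdet, Fin.sum_univ_three, cross_self_fst N h2, cross_self_snd N h2, e1,
      e2, e3, oconj_sub, oconj_smul, hN.oconj_oconj, mul_sub, otr_add, otr_sub, otr_smul,
      mul_smul_comm, ← hN.otr_mul_assoc, hN.otr_mul _ (oconj N _), polar_self, ← r (X.2 0) (X.2 1) (X.2 2),
      r (X.2 2) (X.2 0) (X.2 1)] <;> field_simp <;> ring
  · fin_cases i <;>
    simp [jmul, je, cross_self_fst N h2, cross_self_snd N h2, e1,
      e2, e3, oconj_sub, oconj_smul, hN.oconj_oconj, mul_sub, sub_mul, hN.oconj_mul_mul,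
      hN.mul_mul_oconj, hN.oconj_mul, mul_smul_comm, smul_mul_assoc] <;> module

theorem cross_je (N : QuadraticForm K C) (X : J K C) :
    cross N je X = (2 : K)⁻¹ • (pairForm N X je • je - X) := by
  rw [pairForm_je]
  ext i
  · fin_cases i <;> simp [cross_fst, je, Fin.sum_univ_three] <;> ring_nf <;> norm_num
  · simp [cross_snd, je, oconj, otr]

/-- The degree three equation of `J`, polarized. -/
theorem IsOctonion.cross_cross_add (hN : IsOctonion N) (h2 : (2 : K) ≠ 0) (h3 : (3 : K) ≠ 0)
    (X Y Z : J K C) :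
    cross N X (cross N Y Z) + cross N Y (cross N X Z) + cross N Z (cross N X Y) =
      (2 : K)⁻¹ • ((pairForm N X je * pairForm N (cross N Y Z) je
        + pairForm N Y je * pairForm N (cross N X Z) je
        + pairForm N Z je * pairForm N (cross N X Y) je - pairForm N (cross N X Y) Z) • je
      - pairForm N X je • cross N Y Z - pairForm N Y je • cross N X Z
      - pairForm N Z je • cross N X Y - pairForm N (cross N Y Z) je • X
      - pairForm N (cross N X Z) je • Y - pairForm N (cross N X Y) je • Z) := by
  -- The cubic equation solved for $X\times X^\#$. Writing $\det X$ as $\frac13\langle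
  -- X^\#,X\rangle$ makes every term visibly trilinear, ready for polarization.
  have key : ∀ X : J K C, cross N X (cross N X X) = (2 : K)⁻¹ • ((pairForm N X je *
      pairForm N (cross N X X) je - 3⁻¹ * pairForm N (cross N X X) X) • je
      - pairForm N X je • cross N X X - pairForm N (cross N X X) je • X) := by
    intro X
    have h := hN.jmul_cross_self h2 X
    rw [hN.jmul_eq h2, pairForm_comm N X (cross N X X), hN.pairForm_cross_self h2 h3] at h
    rw [hN.pairForm_cross_self h2 h3]
    linear_combination (norm := (match_scalars <;> field_simp <;> ring)) h
  -- Inclusion and exclusion over the sums of $X,Y,Z$ isolates the trilinear part. It counts each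
  -- term twice, since the cross product is symmetric; hence the factor $\frac12$ at the end.
  have c1 := key (X + Y + Z)
  have c2 := key (X + Y)
  have c3 := key (Y + Z)
  have c4 := key (X + Z)
  have c5 := key X
  have c6 := key Y
  have c7 := key Z
  have s := fun X Y Z : J K C => hN.pairForm_cross_right h2 h3 X Y Z
  have t1 : pairForm N (cross N X Z) Y = pairForm N (cross N X Y) Z := by
    rw [s, s, cross_comm N Z]
  have t2 : pairForm N (cross N Y Z) X = pairForm N (cross N X Y) Z := by
    rw [pairForm_comm, s]
  simp only [map_add, LinearMap.add_apply, cross_comm N Y X, cross_comm N Z X, cross_comm N Z Y,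
    t1, t2] at c1 c2 c3 c4
  linear_combination (norm := (match_scalars <;> field_simp <;> ring)) (2 : K)⁻¹ • (c1 - c2 - c3 - c4 + c5 + c6 + c7)

/-- The product of an isotope in terms of the cross product. -/
theorem IsOctonion.isotopeMul_eq (hN : IsOctonion N) (h2 : (2 : K) ≠ 0) (h3 : (3 : K) ≠ 0)
    (a X Y : J K C) :
    isotopeMul N a X Y = (2 : K)⁻¹ • (pairForm N a X • Y + pairForm N a Y • X)
      - (2 : K) • cross N a (cross N X Y) := by
  -- Expanding the isotope product produces $X\times(a\times Y)+Y\times(a\times X)-a\times(X\times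
  -- Y)$. The polarized cubic equation trades the first two terms for $-a\times(X\times Y)$ and
  -- lower terms, which explains the coefficient $-2$.
  have h := hN.cross_cross_add h2 h3 a X Y
  have s := fun X Y Z : J K C => hN.pairForm_cross_right h2 h3 X Y Z
  have p : ∀ X Y : J K C, pairForm N (cross N X Y) je =
      (2 : K)⁻¹ * (pairForm N X je * pairForm N Y je - pairForm N X Y) := fun X Y => by
    rw [s, cross_comm, cross_je, map_smul, map_sub, map_smul]
    simp only [smul_eq_mul]
    ring
  have t1 : pairForm N (cross N a Y) X = pairForm N (cross N a X) Y := by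
    rw [s, s, cross_comm N Y]
  have t2 : pairForm N (cross N X Y) a = pairForm N (cross N a X) Y := by
    rw [pairForm_comm, s]
  simp only [isotopeMul, hN.jmul_eq h2, map_add, map_sub, map_smul, LinearMap.add_apply,
    LinearMap.sub_apply, LinearMap.smul_apply, cross_comm N _ je, cross_je, p, smul_eq_mul,
    pairForm_je_je, pairForm_comm N X a, pairForm_comm N Y a, pairForm_comm N Y X, pairForm_comm N X (cross N _ _),
    pairForm_comm N Y (cross N _ _), pairForm_comm N a (cross N _ _), t1, t2, cross_comm N X a,
    cross_comm N Y a, cross_comm N Y X] at h ⊢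
  linear_combination (norm := (match_scalars <;> field_simp <;> ring)) h

theorem IsOctonion.isotopeMul_je (hN : IsOctonion N) (h2 : (2 : K) ≠ 0) (h3 : (3 : K) ≠ 0)
    (X Y : J K C) : isotopeMul N je X Y = jmul N X Y := by
  have s := fun X Y Z : J K C => hN.pairForm_cross_right h2 h3 X Y Z
  rw [hN.isotopeMul_eq h2 h3, hN.jmul_eq h2, cross_je, s, cross_comm N Y,
    cross_je, map_smul, map_sub, map_smul, pairForm_comm N je X, pairForm_comm N je Y]
  simp only [smul_eq_mul]
  match_scalars <;> field_simp

end Isotope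

/-! ### The covariant `hess` and the identification of $S_x$ with an isotope product. -/

section Hessian

variable {K : Type u} {C : Type v} [Field K] [NonAssocRing C] [Module K C]
  [SMulCommClass K C C] [IsScalarTower K C C] {N : QuadraticForm K C}

/-- The covariant of a pair of elements of `J` that comes from the Hessian of its binary
cubic form. -/
def hess (N : QuadraticForm K C) (x : V K C) : J K C :=
  (2 * (jD N (x 0) (x 0) (x 1) * jD N (x 1) (x 1) (x 1) - jD N (x 0) (x 1) (x 1) ^ 2)) •
      cross N (x 0) (x 0)
    - (2 * (jD N (x 0) (x 0) (x 0) * jD N (x 1) (x 1) (x 1)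
      - jD N (x 0) (x 0) (x 1) * jD N (x 0) (x 1) (x 1))) • cross N (x 0) (x 1)
    + (2 * (jD N (x 0) (x 0) (x 0) * jD N (x 0) (x 1) (x 1) - jD N (x 0) (x 0) (x 1) ^ 2)) •
      cross N (x 1) (x 1)

/-- Peels off one sign choice at a time, to write out the sixteen terms of $t_4$. -/
theorem sum_fin_succ_arrow_two {M : Type*} [AddCommMonoid M] {n : ℕ}
    (F : (Fin (n + 1) → Fin 2) → M) :
    ∑ f, F f = ∑ f : Fin n → Fin 2, (F (Matrix.vecCons 0 f) + F (Matrix.vecCons 1 f)) := by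
  rw [← (Fin.consEquiv fun _ : Fin (n + 1) => Fin 2).sum_comp, Fintype.sum_prod_type,
    Fin.sum_univ_two, ← Finset.sum_add_distrib]
  rfl

theorem jD_comm (N : QuadraticForm K C) (X Y Z : J K C) : jD N X Y Z = jD N Y X Z := by
  rw [jD, jD, add_comm Y X, add_comm Y Z, add_comm Z X]
  ring

theorem jD_comm' (N : QuadraticForm K C) (X Y Z : J K C) : jD N X Y Z = jD N X Z Y := by
  rw [jD, jD, add_right_comm X Z Y, add_comm Z Y, add_comm X Z, add_comm X Y]
  ring

/-- Two of the eight tensor slots form a cross product and the other six fill the two factors $D$;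
by symmetry of $D$ and $\times$ the sixteen signed terms collect into `hess`. -/
theorem IsOctonion.Phi1_eq (hN : IsOctonion N) (h2 : (2 : K) ≠ 0) (h3 : (3 : K) ≠ 0)
    (x : V K C) (X Y : J K C) :
    Phi1 N x X Y = cross N (hess N x) (cross N X Y) := by
  have s1 : jD N (x 0) (x 1) (x 0) = jD N (x 0) (x 0) (x 1) := jD_comm' ..
  have s2 : jD N (x 1) (x 0) (x 0) = jD N (x 0) (x 0) (x 1) := by rw [jD_comm, s1]
  have s3 : jD N (x 1) (x 0) (x 1) = jD N (x 0) (x 1) (x 1) := jD_comm ..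
  have s4 : jD N (x 1) (x 1) (x 0) = jD N (x 0) (x 1) (x 1) := by rw [jD_comm', s3]
  have r0 : (0 : Fin 2).rev = 1 := rfl
  have r1 : (1 : Fin 2).rev = 0 := rfl
  simp only [Phi1, sum_fin_succ_arrow_two, Fintype.sum_unique, Psi1, t4, t4sign,
    Fin.prod_univ_four, hN.jcross_eq h2 h3, hess]
  simp [r0, r1, s1, s2, s3, s4, cross_comm N (x 1) (x 0)]
  module

theorem IsOctonion.Phi2_eq (hN : IsOctonion N) (h2 : (2 : K) ≠ 0) (h3 : (3 : K) ≠ 0)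
    (x : V K C) (X Y : J K C) :
    Phi2 N x X Y = (3 : K)⁻¹ •
      (pairForm N (hess N x) X • Y + pairForm N (hess N x) Y • X) := by
  have s1 : jD N (x 0) (x 1) (x 0) = jD N (x 0) (x 0) (x 1) := jD_comm' ..
  have s2 : jD N (x 1) (x 0) (x 0) = jD N (x 0) (x 0) (x 1) := by rw [jD_comm, s1]
  have s3 : jD N (x 1) (x 0) (x 1) = jD N (x 0) (x 1) (x 1) := jD_comm ..
  have s4 : jD N (x 1) (x 1) (x 0) = jD N (x 0) (x 1) (x 1) := by rw [jD_comm', s3]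
  have s5 : ∀ X, jD N (x 1) (x 0) X = jD N (x 0) (x 1) X := fun X => jD_comm ..
  have r0 : (0 : Fin 2).rev = 1 := rfl
  have r1 : (1 : Fin 2).rev = 0 := rfl
  have p : ∀ i j X, pairForm N (cross N (x i) (x j)) X = 3 * jD N (x i) (x j) X :=
    fun i j X => (hN.three_jD h2 h3 ..).symm
  simp only [Phi2, sum_fin_succ_arrow_two, Fintype.sum_unique, Psi2, t4, t4sign,
    Fin.prod_univ_four, hess]
  simp [r0, r1, s1, s2, s3, s4, s5, p]
  match_scalars <;> field_simp <;> ring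

/-- The product `S_x` is, up to the factor `9`, the product of an isotope. -/
theorem IsOctonion.S_eq (hN : IsOctonion N) (h2 : (2 : K) ≠ 0) (h3 : (3 : K) ≠ 0)
    (x : V K C) (X Y : J K C) : S N x X Y = (9 : K) • isotopeMul N (hess N x) X Y := by
  -- The normalizing constants match: $-18=9\cdot(-2)$ and $\frac{27}2\cdot\frac13=9\cdot\frac12$.
  rw [S, hN.Phi1_eq h2 h3, hN.Phi2_eq h2 h3, hN.isotopeMul_eq h2 h3]
  match_scalars <;> field_simp <;> ring

theorem IsOctonion.hess_basePt (hN : IsOctonion N) (h2 : (2 : K) ≠ 0) (h3 : (3 : K) ≠ 0) :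
    hess N (basePt : V K C) = (9 : K)⁻¹ • je := by
  have d1 : jD N (basePt 0 : J K C) (basePt 0) (basePt 0) = 0 := by
    rw [hN.jD_eq h2 h3, hN.pairForm_cross_self h2 h3]
    simp [basePt, jdet, otr]
  have d2 : jD N (basePt 1 : J K C) (basePt 1) (basePt 1) = 0 := by
    rw [hN.jD_eq h2 h3, hN.pairForm_cross_self h2 h3]
    simp [basePt, jdet, otr]
  have e1 : (1 : Fin 3) + 2 = 0 := rfl
  have e2 : (2 : Fin 3) + 2 = 1 := rfl
  have e3 : (2 : Fin 3) + 1 = 0 := rfl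
  have d3 : jD N (basePt 0 : J K C) (basePt 0) (basePt 1) = 3⁻¹ := by
    rw [hN.jD_eq h2 h3]
    simp [basePt, pairForm_apply, cross_fst, Fin.sum_univ_three, e1, e2, e3]
    field_simp
    norm_num
  have d4 : jD N (basePt 0 : J K C) (basePt 1) (basePt 1) = -3⁻¹ := by
    rw [hN.jD_eq h2 h3]
    simp [basePt, pairForm_apply, cross_fst, Fin.sum_univ_three, e1, e2, e3]
    field_simp
    norm_num
  have h9 : (9 : K) ≠ 0 := by
    rw [show (9 : K) = 3 * 3 by norm_num]; exact mul_ne_zero h3 h3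
  rw [hess, d1, d2, d3, d4]
  ext i
  · fin_cases i <;> simp [basePt, cross_fst, je, e1, e2, e3] <;> field_simp <;> norm_num
  · simp [basePt, cross_snd, je, oconj, otr]

theorem IsOctonion.S_basePt (hN : IsOctonion N) (h2 : (2 : K) ≠ 0) (h3 : (3 : K) ≠ 0)
    (X Y : J K C) : S N basePt X Y = jmul N X Y := by
  have h9 : (9 : K) ≠ 0 := by
    rw [show (9 : K) = 3 * 3 by norm_num]; exact mul_ne_zero h3 h3
  rw [hN.S_eq h2 h3, hN.hess_basePt h2 h3, ← hN.isotopeMul_je h2 h3, hN.isotopeMul_eq h2 h3,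
    hN.isotopeMul_eq h2 h3]
  simp only [map_smul, LinearMap.smul_apply, smul_eq_mul]
  match_scalars <;> field_simp

theorem IsOctonion.Delta_basePt (hN : IsOctonion N) (h2 : (2 : K) ≠ 0) (h3 : (3 : K) ≠ 0) :
    Delta N (basePt : V K C) = 1 := by
  have e1 : (1 : Fin 3) + 2 = 0 := rfl
  have e2 : (2 : Fin 3) + 2 = 1 := rfl
  have e3 : (2 : Fin 3) + 1 = 0 := rfl
  have d1 : jdet N (basePt 0 : J K C) = 0 := by
    simp [basePt, jdet, otr]
  have d2 : jdet N (basePt 1 : J K C) = 0 := by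
    simp [basePt, jdet, otr]
  have d3 : 3 * jD N (basePt 0 : J K C) (basePt 0) (basePt 1) = 1 := by
    rw [hN.three_jD h2 h3]
    simp [basePt, pairForm_apply, cross_fst, Fin.sum_univ_three, e1, e2, e3]
    field_simp
    norm_num
  have d4 : 3 * jD N (basePt 0 : J K C) (basePt 1) (basePt 1) = -1 := by
    rw [hN.three_jD h2 h3]
    simp [basePt, pairForm_apply, cross_fst, Fin.sum_univ_three, e1, e2, e3]
    field_simp
    norm_num
  simp only [Delta, binCubic, Cubic.discr, d1, d2, d3, d4]
  norm_num

end Hessian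

/-! ### Contragredients and the equivariance of $S$, $\Delta$ and $\mu$. -/

section Equivariance

variable {K : Type u} {C : Type v} [Field K] [NonAssocRing C] [Module K C]
  [SMulCommClass K C C] [IsScalarTower K C C] {N : QuadraticForm K C}

theorem IsOctonion.finite (hN : IsOctonion N) : Module.Finite K C :=
  Module.finite_of_finrank_pos (by rw [hN.finrank_eq]; norm_num)

theorem jdet_je (N : QuadraticForm K C) : jdet N (je : J K C) = 1 := by
  simp [jdet, je, otr]

theorem jdet_apply_of_mem {g : J K C ≃ₗ[K] J K C} (hg : g ∈ GE6 N)
    (X : J K C) : jdet N (g X) = mult N g * jdet N X := by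
  obtain ⟨c, hc⟩ := hg
  rw [mult, hc, hc, jdet_je, mul_one]

theorem mult_ne_zero {g : J K C ≃ₗ[K] J K C} (hg : g ∈ GE6 N) :
    mult N g ≠ 0 := by
  obtain ⟨c, hc⟩ := hg
  rw [mult, hc, jdet_je, mul_one]
  exact c.ne_zero

theorem mult_mul {g h : J K C ≃ₗ[K] J K C} (hg : g ∈ GE6 N) :
    mult N (g * h) = mult N g * mult N h := by
  rw [mult, LinearEquiv.mul_apply, jdet_apply_of_mem hg, mult, mult]

/-- The contragredient of $g$ for the trace form. Cross products of elements of $J$ transform by it,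
not by $g$. -/
theorem IsOctonion.exists_dual (hN : IsOctonion N) (g : J K C ≃ₗ[K] J K C) :
    ∃ g' : J K C ≃ₗ[K] J K C, ∀ X Y, pairForm N (g' X) (g Y) = pairForm N X Y := by
  have := hN.finite
  have hB : (pairForm N).Nondegenerate := by
    have hr : (pairForm N).IsRefl := fun X Y h => by rwa [pairForm_comm]
    exact (LinearMap.IsRefl.nondegenerate_iff_separatingLeft hr).2 fun X h => hN.pairForm_nondegenerate h
  refine ⟨(pairForm N).toDual hB ≪≫ₗ g.symm.dualMap ≪≫ₗ ((pairForm N).toDual hB).symm,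
    fun X Y => ?_⟩
  rw [← LinearMap.BilinForm.toDual_def hB]
  simp [LinearMap.BilinForm.toDual_def]

theorem jD_apply {g : J K C ≃ₗ[K] J K C} (hg : g ∈ GE6 N)
    (X Y Z : J K C) : jD N (g X) (g Y) (g Z) = mult N g * jD N X Y Z := by
  simp only [jD, ← map_add, jdet_apply_of_mem hg]
  ring

theorem IsOctonion.cross_apply (hN : IsOctonion N) (h2 : (2 : K) ≠ 0) (h3 : (3 : K) ≠ 0)
    {g g' : J K C ≃ₗ[K] J K C} (hg : g ∈ GE6 N)
    (hg' : ∀ X Y, pairForm N (g' X) (g Y) = pairForm N X Y) (X Y : J K C) :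
    cross N (g X) (g Y) = mult N g • g' (cross N X Y) := by
  refine hN.ext_pairForm fun Z => ?_
  obtain ⟨Z, rfl⟩ := g.surjective Z
  rw [← hN.three_jD h2 h3, jD_apply hg, map_smul, LinearMap.smul_apply, hg',
    ← hN.three_jD h2 h3, smul_eq_mul]
  ring

/-- The defect $E$ of the claimed rule is symmetric and bilinear, and applying the adjoint identity
to $gX$ shows $E(X^\#,X^\#)=0$. Adjoints need not fill $J$, so $X=e+tY$ is substituted and powers of
$t$ are separated: the linear term gives $E(e,\cdot)=0$, and then the quadratic term gives
$E(Y,Y)=0$. Few values of $t$ suffice, so the field need not be infinite. -/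
theorem IsOctonion.cross_dual (hN : IsOctonion N) (h2 : (2 : K) ≠ 0) (h3 : (3 : K) ≠ 0)
    {g g' : J K C ≃ₗ[K] J K C} (hg : g ∈ GE6 N)
    (hg' : ∀ X Y, pairForm N (g' X) (g Y) = pairForm N X Y) (X Y : J K C) :
    cross N (g' X) (g' Y) = (mult N g)⁻¹ • g (cross N X Y) := by
  have hc := mult_ne_zero hg
  obtain ⟨E, hE⟩ : ∃ E : J K C →ₗ[K] J K C →ₗ[K] J K C, ∀ X Y, E X Y =
      cross N (g' X) (g' Y) - (mult N g)⁻¹ • g (cross N X Y) :=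
    ⟨(cross N).compl₁₂ g'.toLinearMap g'.toLinearMap
      - (mult N g)⁻¹ • (cross N).compr₂ g.toLinearMap, fun X Y => by simp⟩
  have hs : ∀ X Y, E X Y = E Y X := fun X Y => by
    rw [hE, hE, cross_comm N X, cross_comm N (g' X)]
  have h0 : ∀ X, E (cross N X X) (cross N X X) = 0 := fun X => by
    have h := hN.cross_cross_self h2 (g X)
    rw [hN.cross_apply h2 h3 hg hg', jdet_apply_of_mem hg, ← map_smul g] at h
    rw [hE, hN.cross_cross_self h2, sub_eq_zero]
    simp only [map_smul, LinearMap.smul_apply] at h ⊢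
    rw [eq_inv_smul_iff₀ hc]
    refine smul_right_injective _ hc ?_
    simpa [smul_smul] using h
  have ee : cross N (je : J K C) je = je := by
    rw [cross_je, pairForm_je_je]
    match_scalars
    field_simp
    norm_num
  have expand : ∀ (t : K) (Y : J K C), E je je + (4 * t) • E je (cross N je Y)
      + t ^ 2 • ((4 : K) • E (cross N je Y) (cross N je Y) + (2 : K) • E je (cross N Y Y))
      + (4 * t ^ 3) • E (cross N je Y) (cross N Y Y)
      + t ^ 4 • E (cross N Y Y) (cross N Y Y) = 0 := fun t Y => by
    rw [← h0 (je + t • Y)]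
    simp only [map_add, map_smul, LinearMap.add_apply, LinearMap.smul_apply, ee,
      cross_comm N Y je, hs (cross N je Y) je, hs (cross N Y Y) je,
      hs (cross N Y Y) (cross N je Y)]
    module
  have e0 : E je je = 0 := by simpa [ee] using h0 je
  have e1 : ∀ Y, E je (cross N je Y) = 0 := fun Y => by
    have a1 := expand 1 Y
    have a2 := expand (-1) Y
    have a3 := expand 2 Y
    have a4 := expand (-2) Y
    -- The odd part in $t$ has a linear and a cubic coefficient; the values at $\pm1$ and $\pm2$
    -- eliminate the cubic one, leaving $48=2^4\cdot3$.
    have h : (48 : K) • E je (cross N je Y) = 0 := by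
      linear_combination (norm := module) (8 : K) • (a1 - a2) - (a3 - a4)
    have h48 : (48 : K) ≠ 0 := by
      rw [show (48 : K) = 2 ^ 4 * 3 by norm_num]
      exact mul_ne_zero (pow_ne_zero _ h2) h3
    rwa [smul_eq_zero_iff_right h48] at h
  have e2 : ∀ Y, E je Y = 0 := fun Y => by
    have h := e1 Y
    rw [cross_je, map_smul, map_sub, map_smul, e0, smul_zero, zero_sub] at h
    simpa [h2] using h
  have e3 : ∀ Y, E Y Y = 0 := fun Y => by
    have a1 := expand 1 Y
    have a2 := expand (-1) Y
    rw [cross_je] at a1 a2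
    simp only [map_smul, map_sub, LinearMap.smul_apply, LinearMap.sub_apply, hs Y je, e2, h0]
      at a1 a2
    have h : (2 : K) • E Y Y = 0 := by
      -- As $E(e,\cdot)=0$ and $e\times Y=\frac12(\mathrm{Tr}(Y)e-Y)$, only the term $8E(e\times
      -- Y,e\times Y)=2E(Y,Y)$ survives.
      linear_combination (norm := (match_scalars <;> field_simp <;> norm_num)) a1 + a2
    rwa [smul_eq_zero_iff_right h2] at h
  have h := e3 (X + Y)
  simp only [map_add, LinearMap.add_apply, e3, hs Y X] at h
  have h' : (2 : K) • E X Y = 0 := by linear_combination (norm := module) h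
  rw [smul_eq_zero_iff_right h2, hE, sub_eq_zero] at h'
  exact h'

theorem IsOctonion.jdet_dual (hN : IsOctonion N) (h2 : (2 : K) ≠ 0) (h3 : (3 : K) ≠ 0)
    {g g' : J K C ≃ₗ[K] J K C} (hg : g ∈ GE6 N)
    (hg' : ∀ X Y, pairForm N (g' X) (g Y) = pairForm N X Y) (X : J K C) :
    jdet N (g' X) = (mult N g)⁻¹ * jdet N X := by
  have h := hN.pairForm_cross_self h2 h3 (g' X)
  rw [hN.cross_dual h2 h3 hg hg', map_smul, LinearMap.smul_apply, pairForm_comm, hg',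
    pairForm_comm, hN.pairForm_cross_self h2 h3, smul_eq_mul] at h
  exact mul_left_cancel₀ h3 (by linear_combination -h)

theorem IsOctonion.dual_mem (hN : IsOctonion N) (h2 : (2 : K) ≠ 0) (h3 : (3 : K) ≠ 0)
    {g g' : J K C ≃ₗ[K] J K C} (hg : g ∈ GE6 N)
    (hg' : ∀ X Y, pairForm N (g' X) (g Y) = pairForm N X Y) : g' ∈ GE6 N :=
  ⟨(Units.mk0 _ (mult_ne_zero hg))⁻¹, fun X => by
    rw [hN.jdet_dual h2 h3 hg hg']; simp⟩

theorem IsOctonion.jD_self (hN : IsOctonion N) (h2 : (2 : K) ≠ 0) (h3 : (3 : K) ≠ 0)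
    (X : J K C) : jD N X X X = jdet N X := by
  rw [hN.jD_eq h2 h3, hN.pairForm_cross_self h2 h3, inv_mul_cancel_left₀ h3]

theorem IsOctonion.jD_comb (hN : IsOctonion N) (h2 : (2 : K) ≠ 0) (h3 : (3 : K) ≠ 0)
    (X Y : J K C) (p q r s t u : K) :
    jD N (p • X + q • Y) (r • X + s • Y) (t • X + u • Y) =
      p * r * t * jD N X X X + (p * r * u + p * s * t + q * r * t) * jD N X X Y
        + (p * s * u + q * r * u + q * s * t) * jD N X Y Y + q * s * u * jD N Y Y Y := by
  have s1 : jD N X Y X = jD N X X Y := jD_comm' ..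
  have s2 : jD N Y X X = jD N X X Y := by rw [jD_comm, s1]
  have s3 : jD N Y X Y = jD N X Y Y := jD_comm ..
  have s4 : jD N Y Y X = jD N X Y Y := by rw [jD_comm', s3]
  simp only [hN.jD_eq h2 h3] at s1 s2 s3 s4 ⊢
  simp only [map_add, map_smul, LinearMap.add_apply, LinearMap.smul_apply, smul_eq_mul]
  linear_combination p * s * t * s1 + q * r * t * s2 + q * r * u * s3 + q * s * t * s4

theorem act_apply (g : Amb K C) (x : V K C) (i : Fin 2) :
    act g x i = (g.2 : Matrix (Fin 2) (Fin 2) K) i 0 • g.1 (x 0)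
      + (g.2 : Matrix (Fin 2) (Fin 2) K) i 1 • g.1 (x 1) := by
  rw [act, Fin.sum_univ_two]

theorem IsOctonion.jD_act (hN : IsOctonion N) (h2 : (2 : K) ≠ 0) (h3 : (3 : K) ≠ 0)
    {g : Amb K C} (hg : g ∈ G N) (x : V K C) (i j l : Fin 2) :
    jD N (act g x i) (act g x j) (act g x l) =
      let m : Matrix (Fin 2) (Fin 2) K := g.2
      mult N g.1 * (m i 0 * m j 0 * m l 0 * jD N (x 0) (x 0) (x 0)
        + (m i 0 * m j 0 * m l 1 + m i 0 * m j 1 * m l 0 + m i 1 * m j 0 * m l 0) *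
          jD N (x 0) (x 0) (x 1)
        + (m i 0 * m j 1 * m l 1 + m i 1 * m j 0 * m l 1 + m i 1 * m j 1 * m l 0) *
          jD N (x 0) (x 1) (x 1)
        + m i 1 * m j 1 * m l 1 * jD N (x 1) (x 1) (x 1)) := by
  have hg1 : g.1 ∈ GE6 N := hg.1
  simp only [act_apply, hN.jD_comb h2 h3, jD_apply hg1]
  ring

/-- The two factors $D$ and the cross product contribute one multiplier each, and degree $8$ in the
pair gives weight $4$ in the determinant. -/
theorem IsOctonion.hess_act (hN : IsOctonion N) (h2 : (2 : K) ≠ 0) (h3 : (3 : K) ≠ 0)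
    {g : Amb K C} (hg : g ∈ G N) {g' : J K C ≃ₗ[K] J K C}
    (hg' : ∀ X Y, pairForm N (g' X) (g.1 Y) = pairForm N X Y) (x : V K C) :
    hess N (act g x) =
      (mult N g.1 ^ 3 * (g.2 : Matrix (Fin 2) (Fin 2) K).det ^ 4) • g' (hess N x) := by
  have hg1 : g.1 ∈ GE6 N := hg.1
  have hc := fun X Y => hN.cross_apply h2 h3 hg1 hg' X Y
  rw [hess, hess]
  simp only [hN.jD_act h2 h3 hg]
  simp only [act_apply, map_add, map_sub, map_smul, LinearMap.add_apply, LinearMap.smul_apply,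
    hc, cross_comm N (x 1) (x 0), Matrix.det_fin_two]
  match_scalars <;> ring

theorem IsOctonion.Delta_act (hN : IsOctonion N) (h2 : (2 : K) ≠ 0) (h3 : (3 : K) ≠ 0)
    {g : Amb K C} (hg : g ∈ G N) (x : V K C) :
    Delta N (act g x) =
      mult N g.1 ^ 4 * (g.2 : Matrix (Fin 2) (Fin 2) K).det ^ 6 * Delta N x := by
  simp only [Delta, binCubic, Cubic.discr, ← hN.jD_self h2 h3]
  simp only [hN.jD_act h2 h3 hg, Matrix.det_fin_two]
  ring

theorem det_ne_zero (g : GL (Fin 2) K) : (g : Matrix (Fin 2) (Fin 2) K).det ≠ 0 :=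
  ((Matrix.isUnit_iff_isUnit_det _).1 g.isUnit).ne_zero

theorem IsOctonion.S_act (hN : IsOctonion N) (h2 : (2 : K) ≠ 0) (h3 : (3 : K) ≠ 0)
    {g : Amb K C} (hg : g ∈ G N) (x : V K C) (X Y : J K C) :
    S N (act g x) (g.1 X) (g.1 Y) =
      (mult N g.1 ^ 3 * (g.2 : Matrix (Fin 2) (Fin 2) K).det ^ 4) • g.1 (S N x X Y) := by
  obtain ⟨g', hg'⟩ := hN.exists_dual g.1
  have hg1 : g.1 ∈ GE6 N := hg.1
  have hc := mult_ne_zero hg1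
  rw [hN.S_eq h2 h3, hN.S_eq h2 h3, hN.isotopeMul_eq h2 h3, hN.isotopeMul_eq h2 h3,
    hN.hess_act h2 h3 hg hg', hN.cross_apply h2 h3 hg1 hg']
  simp only [map_add, map_sub, map_smul, LinearMap.smul_apply, hg', hN.cross_dual h2 h3 hg1 hg',
    smul_eq_mul]
  match_scalars <;> field_simp

theorem IsOctonion.Delta_act_ne_zero (hN : IsOctonion N) (h2 : (2 : K) ≠ 0) (h3 : (3 : K) ≠ 0)
    {g : Amb K C} (hg : g ∈ G N) {x : V K C} (hx : Delta N x ≠ 0) :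
    Delta N (act g x) ≠ 0 := by
  rw [hN.Delta_act h2 h3 hg]
  exact mul_ne_zero (mul_ne_zero (pow_ne_zero _ (mult_ne_zero hg.1))
    (pow_ne_zero _ (det_ne_zero g.2))) hx

theorem IsOctonion.S_smul_smul (hN : IsOctonion N) (h2 : (2 : K) ≠ 0) (h3 : (3 : K) ≠ 0)
    (x : V K C) (a b : K) (X Y : J K C) : S N x (a • X) (b • Y) = (a * b) • S N x X Y := by
  rw [hN.S_eq h2 h3, hN.S_eq h2 h3, hN.isotopeMul_eq h2 h3, hN.isotopeMul_eq h2 h3]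
  simp only [map_smul, LinearMap.smul_apply, smul_eq_mul]
  module

theorem IsOctonion.mu_prodAt (hN : IsOctonion N) (h2 : (2 : K) ≠ 0) (h3 : (3 : K) ≠ 0)
    {g : Amb K C} (hg : g ∈ G N) {x : V K C} (hx : Delta N x ≠ 0) (X Y : J K C) :
    mu N g (prodAt N x X Y) = prodAt N (act g x) (mu N g X) (mu N g Y) := by
  have hc := mult_ne_zero hg.1
  have hd := det_ne_zero g.2
  rw [prodAt, prodAt, mu, mu, mu, hN.S_smul_smul h2 h3, hN.S_act h2 h3 hg,
    hN.Delta_act h2 h3 hg, map_smul]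
  -- With $c=c(g_1)$ and $d=\det g_2$ the scalars balance: $(cd^2)^2\cdot c^3d^4/(c^4d^6)=cd^2$.
  match_scalars
  field_simp

theorem IsOctonion.prodAt_basePt (hN : IsOctonion N) (h2 : (2 : K) ≠ 0) (h3 : (3 : K) ≠ 0)
    (X Y : J K C) : prodAt N basePt X Y = jmul N X Y := by
  rw [prodAt, hN.Delta_basePt h2 h3, hN.S_basePt h2 h3, inv_one, one_smul]

end Equivariance

/-! ### Transvections and diagonal scalings in $GE_6$. -/

section Transvections

open QuadraticMap

variable {K : Type u} {C : Type v} [Field K] [NonAssocRing C] [Module K C]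
  [SMulCommClass K C C] [IsScalarTower K C C]

/-- The map that adds `u` times row `i + 2` to row `i + 1` (and likewise for the columns) of a
Hermitian matrix. -/
def raise (N : QuadraticForm K C) (i : Fin 3) (u : C) : J K C →ₗ[K] J K C where
  toFun X := (X.1 + Pi.single (i + 1) (polar N u (X.2 i) + N u * X.1 (i + 2)),
    X.2 + Pi.single i (X.1 (i + 2) • u) + Pi.single (i + 2) (oconj N (u * X.2 (i + 1))))
  map_add' X Y := by
    ext j
    · fin_cases i <;> fin_cases j <;> simp <;> ring
    · fin_cases i <;> fin_cases j <;> simp [oconj_add, mul_add] <;> module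
  map_smul' a X := by
    ext j
    · fin_cases i <;> fin_cases j <;> simp <;> ring
    · fin_cases i <;> fin_cases j <;>
        simp [oconj_smul, mul_smul_comm] <;> module

/-- The map that adds `ū` times row `i + 1` to row `i + 2` (and likewise for the columns) of a
Hermitian matrix. -/
def lower (N : QuadraticForm K C) (i : Fin 3) (u : C) : J K C →ₗ[K] J K C where
  toFun X := (X.1 + Pi.single (i + 2) (polar N u (X.2 i) + N u * X.1 (i + 1)),
    X.2 + Pi.single i (X.1 (i + 1) • u) + Pi.single (i + 1) (oconj N (X.2 (i + 2) * u)))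
  map_add' X Y := by
    ext j
    · fin_cases i <;> fin_cases j <;> simp <;> ring
    · fin_cases i <;> fin_cases j <;> simp [oconj_add, add_mul] <;> module
  map_smul' a X := by
    ext j
    · fin_cases i <;> fin_cases j <;> simp <;> ring
    · fin_cases i <;> fin_cases j <;>
        simp [oconj_smul, smul_mul_assoc] <;> module

theorem raise_apply (N : QuadraticForm K C) (i : Fin 3) (u : C) (X : J K C) :
    raise N i u X = (X.1 + Pi.single (i + 1) (polar N u (X.2 i) + N u * X.1 (i + 2)),
      X.2 + Pi.single i (X.1 (i + 2) • u) + Pi.single (i + 2) (oconj N (u * X.2 (i + 1)))) :=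
  rfl

theorem lower_apply (N : QuadraticForm K C) (i : Fin 3) (u : C) (X : J K C) :
    lower N i u X = (X.1 + Pi.single (i + 2) (polar N u (X.2 i) + N u * X.1 (i + 1)),
      X.2 + Pi.single i (X.1 (i + 1) • u) + Pi.single (i + 1) (oconj N (X.2 (i + 2) * u))) :=
  rfl

theorem raise_raise (N : QuadraticForm K C) (i : Fin 3) (u v : C) (h : u + v = 0) (X : J K C) :
    raise N i u (raise N i v X) = X := by
  obtain rfl := eq_neg_of_add_eq_zero_left h
  ext j
  · fin_cases i <;> fin_cases j <;> simp [raise_apply, polar_self] <;> ring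
  · fin_cases i <;> fin_cases j <;> simp [raise_apply, oconj, otr] <;> abel

theorem lower_lower (N : QuadraticForm K C) (i : Fin 3) (u v : C) (h : u + v = 0) (X : J K C) :
    lower N i u (lower N i v X) = X := by
  obtain rfl := eq_neg_of_add_eq_zero_left h
  ext j
  · fin_cases i <;> fin_cases j <;> simp [lower_apply, polar_self] <;> ring
  · fin_cases i <;> fin_cases j <;> simp [lower_apply, oconj, otr] <;> abel

variable {N : QuadraticForm K C}

/-- An elementary row and column operation involves a single octonion $u$, and alternativity
($u(\bar u y)=N(u)y$) is enough associativity for the determinant to be preserved. -/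
theorem IsOctonion.jdet_raise (hN : IsOctonion N) (i : Fin 3) (u : C) (X : J K C) :
    jdet N (raise N i u X) = jdet N X := by
  have e1 : (raise N i u X).1 i = X.1 i := by fin_cases i <;> simp [raise_apply]
  have e2 : (raise N i u X).1 (i + 1) = X.1 (i + 1) + (polar N u (X.2 i) + N u * X.1 (i + 2)) := by
    fin_cases i <;> simp [raise_apply]
  have e3 : (raise N i u X).1 (i + 2) = X.1 (i + 2) := by fin_cases i <;> simp [raise_apply]
  have e4 : (raise N i u X).2 i = X.2 i + X.1 (i + 2) • u := by fin_cases i <;> simp [raise_apply]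
  have e5 : (raise N i u X).2 (i + 1) = X.2 (i + 1) := by fin_cases i <;> simp [raise_apply]
  have e6 : (raise N i u X).2 (i + 2) = X.2 (i + 2) + oconj N (u * X.2 (i + 1)) := by
    fin_cases i <;> simp [raise_apply]
  have p : polar N (X.2 (i + 2)) (oconj N (u * X.2 (i + 1))) =
      otr N (u * (X.2 (i + 1) * X.2 (i + 2))) := by
    rw [← hN.otr_mul, hN.otr_mul_comm, hN.otr_mul_assoc]
  rw [hN.jdet_eq _ i, hN.jdet_eq X i, e1, e2, e3, e4, e5, e6, map_add_eq, map_add_eq,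
    hN.norm_oconj, hN.norm_mul, p, QuadraticMap.map_smul, hN.oconj_mul]
  simp only [mul_add, add_mul, mul_smul_comm, smul_mul_assoc, hN.mul_oconj_mul, otr_add, otr_smul, hN.otr_mul _ (oconj N u), hN.oconj_oconj, polar_self,
    polar_smul_right, smul_eq_mul, polar_comm N (X.2 i) u]
  ring

theorem IsOctonion.jdet_lower (hN : IsOctonion N) (i : Fin 3) (u : C) (X : J K C) :
    jdet N (lower N i u X) = jdet N X := by
  have e1 : (lower N i u X).1 i = X.1 i := by fin_cases i <;> simp [lower_apply]
  have e2 : (lower N i u X).1 (i + 2) = X.1 (i + 2) + (polar N u (X.2 i) + N u * X.1 (i + 1)) := by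
    fin_cases i <;> simp [lower_apply]
  have e3 : (lower N i u X).1 (i + 1) = X.1 (i + 1) := by fin_cases i <;> simp [lower_apply]
  have e4 : (lower N i u X).2 i = X.2 i + X.1 (i + 1) • u := by fin_cases i <;> simp [lower_apply]
  have e5 : (lower N i u X).2 (i + 2) = X.2 (i + 2) := by fin_cases i <;> simp [lower_apply]
  have e6 : (lower N i u X).2 (i + 1) = X.2 (i + 1) + oconj N (X.2 (i + 2) * u) := by
    fin_cases i <;> simp [lower_apply]
  have p : polar N (X.2 (i + 1)) (oconj N (X.2 (i + 2) * u)) =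
      otr N (u * (X.2 (i + 1) * X.2 (i + 2))) := by
    rw [← hN.otr_mul, ← hN.otr_mul_assoc, hN.otr_mul_comm]
  have q : oconj N u * oconj N (X.2 (i + 2)) * X.2 (i + 2) = N (X.2 (i + 2)) • oconj N u := by
    have := hN.mul_mul_oconj (oconj N (X.2 (i + 2))) (oconj N u)
    rwa [hN.oconj_oconj, hN.norm_oconj] at this
  rw [hN.jdet_eq _ i, hN.jdet_eq X i, e1, e2, e3, e4, e5, e6, map_add_eq, map_add_eq,
    hN.norm_oconj, hN.norm_mul, p, QuadraticMap.map_smul, hN.oconj_mul]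
  simp only [mul_add, add_mul, mul_smul_comm, smul_mul_assoc, q, otr_add, otr_smul, hN.otr_mul _ (oconj N u), hN.oconj_oconj, polar_self,
    polar_smul_right, smul_eq_mul, polar_comm N (X.2 i) u]
  ring

/-- The element of `GE₆` given by `raise`. -/
theorem IsOctonion.exists_raise (hN : IsOctonion N) (i : Fin 3) (u : C) :
    ∃ g ∈ GE6 N, ∀ X, g X = raise N i u X :=
  ⟨LinearEquiv.ofLinearMap (raise N i u) (raise N i (-u))
    (LinearMap.ext fun X => raise_raise N i u (-u) (add_neg_cancel u) X)
    (LinearMap.ext fun X => raise_raise N i (-u) u (neg_add_cancel u) X),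
    ⟨1, fun X => by simpa using hN.jdet_raise i u X⟩, fun _ => rfl⟩

theorem IsOctonion.exists_lower (hN : IsOctonion N) (i : Fin 3) (u : C) :
    ∃ g ∈ GE6 N, ∀ X, g X = lower N i u X :=
  ⟨LinearEquiv.ofLinearMap (lower N i u) (lower N i (-u))
    (LinearMap.ext fun X => lower_lower N i u (-u) (add_neg_cancel u) X)
    (LinearMap.ext fun X => lower_lower N i (-u) u (neg_add_cancel u) X),
    ⟨1, fun X => by simpa using hN.jdet_lower i u X⟩, fun _ => rfl⟩

/-- The diagonal idempotent with entry `1` in position `i`. -/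
def diagUnit (K : Type u) (C : Type v) [Field K] [AddCommGroup C] (i : Fin 3) : J K C :=
  (Pi.single i 1, 0)

theorem exists_diag (N : QuadraticForm K C) (r : Fin 3 → K) (hr : ∀ i, r i ≠ 0) :
    ∃ g ∈ GE6 N, ∀ X, g X =
      (fun i => r i ^ 2 * X.1 i, fun i => (r (i + 1) * r (i + 2)) • X.2 i) := by
  let f : (Fin 3 → K) → J K C →ₗ[K] J K C := fun r =>
    { toFun := fun X => (fun i => r i ^ 2 * X.1 i, fun i => (r (i + 1) * r (i + 2)) • X.2 i)
      map_add' := fun X Y => by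
        ext i
        · simp [mul_add]
        · simp
      map_smul' := fun a X => by
        ext i
        · simp; ring
        · simp [smul_smul]; ring_nf }
  refine ⟨LinearEquiv.ofLinearMap (f r) (f fun i => (r i)⁻¹) (LinearMap.ext fun X => ?_)
    (LinearMap.ext fun X => ?_), ⟨Units.mk0 ((r 0 * r 1 * r 2) ^ 2)
      (pow_ne_zero _ (mul_ne_zero (mul_ne_zero (hr 0) (hr 1)) (hr 2))), fun X => ?_⟩, fun _ => rfl⟩
  · ext i
    · have := hr i
      simp [f]; field_simp
    · have h1 := hr (i + 1)
      have h2 := hr (i + 2)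
      simp [f, smul_smul]
      rw [show r (i + 1) * r (i + 2) * ((r (i + 1))⁻¹ * (r (i + 2))⁻¹) = 1 by field_simp, one_smul]
  · ext i
    · have := hr i
      simp [f]; field_simp
    · have h1 := hr (i + 1)
      have h2 := hr (i + 2)
      simp [f, smul_smul]
      rw [show (r (i + 1))⁻¹ * (r (i + 2))⁻¹ * (r (i + 1) * r (i + 2)) = 1 by field_simp, one_smul]
  · have e1 : (1 : Fin 3) + 2 = 0 := rfl
    have e2 : (2 : Fin 3) + 2 = 1 := rfl
    have e3 : (2 : Fin 3) + 1 = 0 := rfl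
    have e4 : (1 : Fin 3) + 1 = 2 := rfl
    simp only [LinearEquiv.coe_ofLinearMap, LinearMap.coe_mk, AddHom.coe_mk, f, jdet,
      Fin.sum_univ_three, smul_mul_assoc, mul_smul_comm, otr_smul, QuadraticMap.map_smul,
      smul_eq_mul, Units.val_mk0, zero_add, e1, e2, e3, e4]
    ring

/-- The expression is the new diagonal entry after a transvection by $u$. If it vanished for all
$u$, the values at $0$, $\pm u$ and $1$ would kill $s$, then $x$, then $t$. -/
theorem IsOctonion.exists_quadratic_ne_zero (hN : IsOctonion N) (h2 : (2 : K) ≠ 0) (s t : K) (x : C)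
    (h : ¬ (s = 0 ∧ t = 0 ∧ x = 0)) : ∃ u, s + (polar N u x + N u * t) ≠ 0 := by
  by_contra! H
  have hs : s = 0 := by simpa using H 0
  have hp : ∀ u, polar N u x = 0 := fun u => by
    have a := H u
    have b := H (-u)
    rw [polar_neg_left, QuadraticMap.map_neg] at b
    exact mul_left_cancel₀ h2 (by linear_combination a - b)
  refine h ⟨hs, ?_, hN.nondegenerate _ fun u => by rw [polar_comm, hp]⟩
  simpa [hs, hp, hN.norm_one] using H 1

end Transvections

/-- An irreducible factor has degree $1$, $2$ or $3$, which is nonzero in $K$; its derivative is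
then nonzero and the factor is separable. -/
theorem exists_root_of_natDegree_eq_three {K : Type u} [Field K] [IsSepClosed K]
    (h2 : (2 : K) ≠ 0) (h3 : (3 : K) ≠ 0) (f : Polynomial K) (hf : f.natDegree = 3) :
    ∃ t, f.eval t = 0 := by
  have h0 : f ≠ 0 := by rintro rfl; simp at hf
  obtain ⟨q, hq, hqf⟩ := WfDvdMonoid.exists_irreducible_factor
    (Polynomial.not_isUnit_of_natDegree_pos f (by omega)) h0
  have hle : q.natDegree ≤ 3 := hf ▸ Polynomial.natDegree_le_of_dvd hqf h0
  have hpos : 0 < q.natDegree := hq.natDegree_pos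
  have hd : (q.natDegree : K) ≠ 0 := by
    interval_cases q.natDegree <;> simp [h2, h3]
  have hsep : q.Separable := by
    rw [Polynomial.separable_iff_derivative_ne_zero hq]
    intro h
    have := congrArg (fun p => p.coeff (q.natDegree - 1)) h
    simp only [Polynomial.coeff_derivative, Polynomial.coeff_zero] at this
    rw [Nat.sub_add_cancel hpos, mul_eq_zero, Nat.cast_sub hpos] at this
    rcases this with h | h
    · exact hq.ne_zero (Polynomial.leadingCoeff_eq_zero.1 h)
    · simp at h; exact hd h
  obtain ⟨t, ht⟩ := IsSepClosed.exists_root q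
    (by rw [Polynomial.degree_eq_natDegree hq.ne_zero]; exact_mod_cast hpos.ne') hsep
  exact ⟨t, Polynomial.eval_eq_zero_of_dvd_of_eval_eq_zero hqf ht⟩

/-! ### Simultaneous diagonalization of elements of rank one. -/

section Diagonalize

open QuadraticMap

variable {K : Type u} {C : Type v} [Field K] [NonAssocRing C] [Module K C]
  [SMulCommClass K C C] [IsScalarTower K C C] {N : QuadraticForm K C}

theorem IsOctonion.cross_self_eq_zero (hN : IsOctonion N) (h2 : (2 : K) ≠ 0) (h3 : (3 : K) ≠ 0)
    {g : J K C ≃ₗ[K] J K C} (hg : g ∈ GE6 N) {X : J K C} (hX : cross N X X = 0) :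
    cross N (g X) (g X) = 0 := by
  obtain ⟨g', hg'⟩ := hN.exists_dual g
  rw [hN.cross_apply h2 h3 hg hg', hX, map_zero, smul_zero]

/-- An element of rank one with a nonzero diagonal entry is moved to a diagonal matrix unit,
keeping the two other ones fixed. -/
theorem IsOctonion.exists_clear (hN : IsOctonion N) (h2 : (2 : K) ≠ 0) (h3 : (3 : K) ≠ 0)
    (i : Fin 3) {X : J K C} (hX : cross N X X = 0) (hs : X.1 i ≠ 0) :
    ∃ g ∈ GE6 N, (∃ a : K, g X = a • diagUnit K C i) ∧
      g (diagUnit K C (i + 1)) = diagUnit K C (i + 1) ∧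
      g (diagUnit K C (i + 2)) = diagUnit K C (i + 2) := by
  -- Two steps of Gaussian elimination with pivot $s_i$: the off-diagonal entries sharing a row with
  -- it are $x_{i+1}$ and $x_{i+2}$.
  obtain ⟨g₁, hg₁, h₁⟩ := hN.exists_raise (i + 1) (-(X.1 i)⁻¹ • X.2 (i + 1))
  obtain ⟨g₂, hg₂, h₂⟩ := hN.exists_lower (i + 2) (-(X.1 i)⁻¹ • (g₁ X).2 (i + 2))
  have hg := mul_mem hg₂ hg₁
  have hXg := hN.cross_self_eq_zero h2 h3 hg hX
  refine ⟨g₂ * g₁, hg, ?_, ?_, ?_⟩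
  · set Y := (g₂ * g₁) X with hY
    have e0 : (g₁ X).1 i = X.1 i := by
      rw [h₁]; fin_cases i <;> simp [raise_apply]
    have e0' : Y.1 i = X.1 i := by
      rw [hY, LinearEquiv.mul_apply, h₂, ← e0]; fin_cases i <;> simp [lower_apply]
    have e1 : (g₁ X).2 (i + 1) = 0 := by
      rw [h₁]
      fin_cases i <;> simp [raise_apply, smul_smul] <;> simp_all
    have e1' : Y.2 (i + 1) = 0 := by
      rw [← e1, hY, LinearEquiv.mul_apply, h₂]; fin_cases i <;> simp [lower_apply]
    have e2 : Y.2 (i + 2) = 0 := by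
      rw [hY, LinearEquiv.mul_apply, h₂]
      have : (g₁ X).1 i ≠ 0 := by rwa [e0]
      rw [← e0]
      fin_cases i <;> simp [lower_apply, smul_smul] <;> simp_all
    -- Once the row of the pivot is cleared, three entries of the equation $Y^\#=0$ are the pivot
    -- times the entries of the complementary block, up to sign.
    have c1 := congrArg (fun Z : J K C => Z.1 (i + 1)) hXg
    have c2 := congrArg (fun Z : J K C => Z.1 (i + 2)) hXg
    have c3 := congrArg (fun Z : J K C => Z.2 i) hXg
    simp only [cross_self_fst N h2, cross_self_snd N h2, e1', e2] at c1 c2 c3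
    have f1 : i + 1 + 1 = i + 2 := by fin_cases i <;> rfl
    have f2 : i + 1 + 2 = i := by fin_cases i <;> rfl
    have f3 : i + 2 + 1 = i := by fin_cases i <;> rfl
    have f4 : i + 2 + 2 = i + 1 := by fin_cases i <;> rfl
    have hs' : Y.1 i ≠ 0 := by rwa [e0']
    rw [f1, f2] at c1
    rw [f3, f4] at c2
    have d1 : Y.1 (i + 2) = 0 := by simpa [hs'] using c1
    have d2 : Y.1 (i + 1) = 0 := by simpa [hs'] using c2
    have d3 : Y.2 i = 0 := by simpa [hs', oconj, otr] using c3
    refine ⟨Y.1 i, ?_⟩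
    ext j
    · fin_cases i <;> fin_cases j <;> simp_all [diagUnit]
    · fin_cases i <;> fin_cases j <;> simp_all [diagUnit]
  · rw [LinearEquiv.mul_apply, h₁, h₂]
    fin_cases i <;> simp [lower_apply, raise_apply, diagUnit, oconj, otr]
  · rw [LinearEquiv.mul_apply, h₁, h₂]
    fin_cases i <;> simp [lower_apply, raise_apply, diagUnit, oconj, otr]

/-- The transvection acts within the block complementary to $i$, so it creates a pivot there without
disturbing the matrix unit already placed at $i$. -/
theorem IsOctonion.exists_fst_ne_zero (hN : IsOctonion N) (h2 : (2 : K) ≠ 0) (i : Fin 3)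
    {X : J K C} (hX : ¬ (X.1 (i + 1) = 0 ∧ X.1 (i + 2) = 0 ∧ X.2 i = 0)) :
    ∃ g ∈ GE6 N, (g X).1 (i + 1) ≠ 0 ∧ g (diagUnit K C i) = diagUnit K C i := by
  obtain ⟨u, hu⟩ := hN.exists_quadratic_ne_zero h2 _ _ _ hX
  obtain ⟨g, hg, h⟩ := hN.exists_raise i u
  refine ⟨g, hg, ?_, ?_⟩
  · rw [h]
    fin_cases i <;> simpa [raise_apply] using hu
  · rw [h]
    fin_cases i <;> simp [raise_apply, diagUnit, oconj, otr]

theorem IsOctonion.exists_fst_zero_ne_zero (hN : IsOctonion N) (h2 : (2 : K) ≠ 0)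
    {X : J K C} (hX : X ≠ 0) : ∃ g ∈ GE6 N, (g X).1 0 ≠ 0 := by
  have key : ∀ X : J K C, X.1 1 ≠ 0 → ∃ g ∈ GE6 N, (g X).1 0 ≠ 0 := fun X h => by
    obtain ⟨g, hg, h, -⟩ := hN.exists_fst_ne_zero h2 2 (X := X) (fun H => h H.2.1)
    exact ⟨g, hg, h⟩
  by_cases h : X.1 1 = 0 ∧ X.1 2 = 0 ∧ X.2 0 = 0
  · by_cases h' : X.1 0 = 0 ∧ X.1 1 = 0 ∧ X.2 2 = 0
    · have hx : ¬ (X.1 0 = 0 ∧ X.1 2 = 0 ∧ X.2 1 = 0) := fun H => hX (by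
        ext i
        · fin_cases i <;> simp [h, h']
        · fin_cases i <;> simp [h, h', H])
      obtain ⟨u, hu⟩ := hN.exists_quadratic_ne_zero h2 _ _ _ hx
      obtain ⟨g, hg, h⟩ := hN.exists_lower 1 u
      refine ⟨g, hg, ?_⟩
      rw [h]
      simpa [lower_apply] using hu
    · obtain ⟨g, hg, h, -⟩ := hN.exists_fst_ne_zero h2 2 (X := X) h'
      exact ⟨g, hg, h⟩
  · obtain ⟨g, hg, h, -⟩ := hN.exists_fst_ne_zero h2 0 (X := X) h
    obtain ⟨g', hg', h'⟩ := key _ h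
    exact ⟨g' * g, mul_mem hg' hg, h'⟩

theorem cross_diagUnit (N : QuadraticForm K C) (i : Fin 3) (X : J K C)
    (h : X.1 (i + 1) = 0 ∧ X.1 (i + 2) = 0 ∧ X.2 i = 0) : cross N (diagUnit K C i) X = 0 := by
  obtain ⟨h1, h2, h3⟩ := h
  ext j
  · fin_cases i <;> fin_cases j <;> simp_all [cross_fst, diagUnit]
  · fin_cases i <;> fin_cases j <;> simp_all [cross_snd, diagUnit, oconj, otr]

/-- Three elements of rank one in general position are moved to multiples of the diagonal
matrix units. -/
theorem IsOctonion.exists_simultaneous (hN : IsOctonion N) (h2 : (2 : K) ≠ 0)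
    (h3 : (3 : K) ≠ 0) {P Q R : J K C} (hP : cross N P P = 0) (hQ : cross N Q Q = 0)
    (hR : cross N R R = 0) (hD : jD N P Q R ≠ 0) :
    ∃ g ∈ GE6 N, ∃ p q r : K, g P = p • diagUnit K C 0 ∧ g Q = q • diagUnit K C 1 ∧
      g R = r • diagUnit K C 2 := by
  have hD' : ∀ g ∈ GE6 N, jD N (g P) (g Q) (g R) ≠ 0 := fun g hg => by
    rw [jD_apply hg]; exact mul_ne_zero (mult_ne_zero hg) hD
  have hP0 : P ≠ 0 := by
    rintro rfl
    rw [hN.jD_eq h2 h3] at hD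
    simp at hD
  obtain ⟨g₁, hg₁, k₁⟩ := hN.exists_fst_zero_ne_zero h2 hP0
  obtain ⟨g₂, hg₂, ⟨p, k₂⟩, -⟩ :=
    hN.exists_clear h2 h3 0 (hN.cross_self_eq_zero h2 h3 hg₁ hP) k₁
  have hg₂₁ := mul_mem hg₂ hg₁
  have m₂ : (g₂ * g₁) P = p • diagUnit K C 0 := k₂
  -- If the block of $Q$ complementary to position $0$ vanished, then $P\times Q=0$, against
  -- $D(P,Q,R)\ne0$.
  obtain ⟨g₃, hg₃, k₃, l₃⟩ := hN.exists_fst_ne_zero h2 0 (X := (g₂ * g₁) Q) (fun H => by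
    have := hD' _ hg₂₁
    rw [hN.jD_eq h2 h3, m₂, map_smul, LinearMap.smul_apply, cross_diagUnit N 0 _ H] at this
    simp at this)
  have hg₃₁ := mul_mem hg₃ hg₂₁
  obtain ⟨g₄, hg₄, ⟨q, k₄⟩, -, l₄⟩ :=
    hN.exists_clear h2 h3 1 (hN.cross_self_eq_zero h2 h3 hg₃₁ hQ) k₃
  have hg₄₁ := mul_mem hg₄ hg₃₁
  have l₄' : g₄ (diagUnit K C 0) = diagUnit K C 0 := l₄
  have m₄ : (g₄ * (g₃ * (g₂ * g₁))) P = p • diagUnit K C 0 := by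
    rw [LinearEquiv.mul_apply, LinearEquiv.mul_apply, m₂, map_smul, map_smul, l₃, l₄']
  have n₄ : (g₄ * (g₃ * (g₂ * g₁))) Q = q • diagUnit K C 1 := k₄
  -- With $P$ and $Q$ diagonal, $D(P,Q,R)$ is proportional to the last diagonal entry of $R$, so the
  -- pivot is already there.
  obtain ⟨g₅, hg₅, ⟨r, k₅⟩, l₅, l₆⟩ :=
    hN.exists_clear h2 h3 2 (X := (g₄ * (g₃ * (g₂ * g₁))) R)
    (hN.cross_self_eq_zero h2 h3 hg₄₁ hR) (fun H => by
      have := hD' _ hg₄₁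
      rw [hN.jD_eq h2 h3, m₄, n₄] at this
      simp [pairForm_apply, cross_fst, cross_snd, diagUnit, Fin.sum_univ_three, oconj,
        otr] at this
      exact this.2.2 H)
  have l₅' : g₅ (diagUnit K C 0) = diagUnit K C 0 := l₅
  have l₆' : g₅ (diagUnit K C 1) = diagUnit K C 1 := l₆
  refine ⟨g₅ * (g₄ * (g₃ * (g₂ * g₁))), mul_mem hg₅ hg₄₁, p, q, r, ?_, ?_, k₅⟩
  · rw [LinearEquiv.mul_apply, m₄, map_smul, l₅']
  · rw [LinearEquiv.mul_apply, n₄, map_smul, l₆']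

end Diagonalize

/-! ### Transitivity on semistable points over a separably closed field. -/

section Transitivity

open QuadraticMap

variable {K : Type u} {C : Type v} [Field K] [NonAssocRing C] [Module K C]
  [SMulCommClass K C C] [IsScalarTower K C C] {N : QuadraticForm K C}

theorem act_mul (g h : Amb K C) (x : V K C) : act (g * h) x = act g (act h x) := by
  ext1 i
  simp only [act, Prod.fst_mul, Prod.snd_mul, Units.val_mul, Matrix.mul_apply, Fin.sum_univ_two,
    LinearEquiv.mul_apply, map_add, map_smul]
  module

theorem act_one (x : V K C) : act (1 : Amb K C) x = x := by
  ext1 i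
  fin_cases i <;> simp [act]

theorem act_inv_act (g : Amb K C) (x : V K C) : act g⁻¹ (act g x) = x := by
  rw [← act_mul, inv_mul_cancel, act_one]

theorem mem_G_of_snd (N : QuadraticForm K C) (m : GL (Fin 2) K) : ((1, m) : Amb K C) ∈ G N :=
  ⟨one_mem _, trivial⟩

theorem mem_G_of_fst {g : J K C ≃ₗ[K] J K C} (hg : g ∈ GE6 N) : ((g, 1) : Amb K C) ∈ G N :=
  ⟨hg, trivial⟩

theorem act_fst (g : J K C ≃ₗ[K] J K C) (x : V K C) (i : Fin 2) :
    act ((g, 1) : Amb K C) x i = g (x i) := by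
  fin_cases i <;> simp [act]

theorem exists_act_eq_comb (N : QuadraticForm K C) (x : V K C) (p q r s : K)
    (h : p * s - q * r ≠ 0) : ∃ g ∈ G N, act g x 0 = p • x 0 + q • x 1 ∧
      act g x 1 = r • x 0 + s • x 1 :=
  ⟨(1, Matrix.GeneralLinearGroup.mkOfDetNeZero !![p, q; r, s]
    (by rwa [Matrix.det_fin_two_of])), mem_G_of_snd N _, by
    rw [act_apply]; rfl, by rw [act_apply]; rfl⟩

theorem IsOctonion.jdet_comb (hN : IsOctonion N) (h2 : (2 : K) ≠ 0) (h3 : (3 : K) ≠ 0)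
    (X Y : J K C) (p q : K) :
    jdet N (p • X + q • Y) = p ^ 3 * jdet N X + p ^ 2 * q * (3 * jD N X X Y)
      + p * q ^ 2 * (3 * jD N X Y Y) + q ^ 3 * jdet N Y := by
  rw [← hN.jD_self h2 h3, hN.jD_comb h2 h3, hN.jD_self h2 h3, hN.jD_self h2 h3]
  ring

variable [IsSepClosed K]

theorem IsOctonion.exists_jdet_eq_zero (hN : IsOctonion N) (h2 : (2 : K) ≠ 0)
    (h3 : (3 : K) ≠ 0) (x : V K C) : ∃ g ∈ G N, jdet N (act g x 0) = 0 := by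
  by_cases h : jdet N (x 0) = 0
  · exact ⟨1, one_mem _, by rwa [act_one]⟩
  · obtain ⟨t, ht⟩ := exists_root_of_natDegree_eq_three h2 h3 (binCubic N x).toPoly
      (Cubic.natDegree_of_a_ne_zero h)
    obtain ⟨g, hg, h₀, -⟩ := exists_act_eq_comb N x t 1 1 0 (by simp)
    refine ⟨g, hg, ?_⟩
    rw [h₀, hN.jdet_comb h2 h3]
    simp only [Cubic.toPoly, binCubic, Polynomial.eval_add, Polynomial.eval_mul,
      Polynomial.eval_C, Polynomial.eval_pow, Polynomial.eval_X] at ht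
    linear_combination ht

/-- The binary cubic form of a semistable point can be moved to one with the roots
`(1, 0)`, `(0, 1)` and `(1, 1)`. -/
theorem IsOctonion.exists_three_roots (hN : IsOctonion N) (h2 : (2 : K) ≠ 0)
    (h3 : (3 : K) ≠ 0) {x : V K C} (hx : Delta N x ≠ 0) :
    ∃ g ∈ G N, jdet N (act g x 0) = 0 ∧ jdet N (act g x 1) = 0 ∧
      jdet N (act g x 0 + act g x 1) = 0 := by
  obtain ⟨g, hg, h₀⟩ := hN.exists_jdet_eq_zero h2 h3 x
  set y := act g x with hy
  have hΔ : Delta N y ≠ 0 := hN.Delta_act_ne_zero h2 h3 hg hx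
  obtain ⟨b, hb⟩ : ∃ b, b = 3 * jD N (y 0) (y 0) (y 1) := ⟨_, rfl⟩
  obtain ⟨c, hc⟩ : ∃ c, c = 3 * jD N (y 0) (y 1) (y 1) := ⟨_, rfl⟩
  obtain ⟨d, hd⟩ : ∃ d, d = jdet N (y 1) := ⟨_, rfl⟩
  have hF := fun p q => hN.jdet_comb h2 h3 (y 0) (y 1) p q
  simp only [Delta, binCubic, Cubic.discr, h₀, ← hb, ← hc, ← hd] at hΔ hF
  have : NeZero (2 : K) := ⟨h2⟩
  obtain ⟨r, hr⟩ := IsSepClosed.exists_eq_mul_self (c ^ 2 - 4 * b * d)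
  have hΔ' : b ^ 2 * (r * r) ≠ 0 := by
    rw [← hr]
    intro h
    exact hΔ (by linear_combination h)
  have hb0 : b ≠ 0 := by rintro rfl; simp at hΔ'
  have hr0 : r ≠ 0 := by rintro rfl; simp at hΔ'
  -- The form is now $q(bp^2+cpq+dq^2)$, with remaining roots $(-c\pm r,2b)$ where $r^2=c^2-4bd$.
  -- The root $(1,0)$ is scaled by $2r$ so that it and $(-c-r,2b)$ add up to $(-c+r,2b)$.
  obtain ⟨m, hm, k₀, k₁⟩ := exists_act_eq_comb N y (2 * r) 0 (-c - r) (2 * b) (by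
    rw [zero_mul, sub_zero]
    exact mul_ne_zero (mul_ne_zero h2 hr0) (mul_ne_zero h2 hb0))
  refine ⟨m * g, mul_mem hm hg, ?_⟩
  rw [act_mul, ← hy, k₀, k₁]
  refine ⟨?_, ?_, ?_⟩
  · rw [hF]; ring
  · rw [hF]
    linear_combination -2 * b ^ 2 * hr
  · rw [show (2 * r) • y 0 + (0 : K) • y 1 + ((-c - r) • y 0 + (2 * b) • y 1) =
      (-c + r) • y 0 + (2 * b) • y 1 by module, hF]
    linear_combination -2 * b ^ 2 * hr

omit [IsSepClosed K] in
-- Comparing coefficients of $t^3$ in the adjoint identity for $a+tb$ gives $4\,b^\#\times(a\times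
-- b)=3D(a,b,b)\,b$. Pairing with $a^\#$ evaluates the form as a nonzero multiple of
-- $D(a,a,b)D(a,b,b)$, because $a^\#$ and $b^\#$ have zero adjoint.
theorem IsOctonion.jD_cross_self_ne_zero (hN : IsOctonion N) (h2 : (2 : K) ≠ 0)
    (h3 : (3 : K) ≠ 0) {a b : J K C} (ha : jdet N a = 0) (hb : jdet N b = 0)
    (hΔ : 3 * jD N a a b ≠ 0 ∧ 3 * jD N a b b ≠ 0) :
    jD N (cross N b b) (cross N (a + b) (a + b)) (cross N a a) ≠ 0 := by
  obtain ⟨f, hf⟩ : ∃ f, f = 3 * jD N a a b := ⟨_, rfl⟩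
  obtain ⟨h, hh⟩ : ∃ h, h = 3 * jD N a b b := ⟨_, rfl⟩
  rw [← hf, ← hh] at hΔ
  have hF := hN.jdet_comb h2 h3 a b
  rw [ha, hb, ← hf, ← hh] at hF
  have hA : cross N (cross N a a) (cross N a a) = 0 := by
    rw [hN.cross_cross_self h2, ha, zero_smul]
  have hB : cross N (cross N b b) (cross N b b) = 0 := by
    rw [hN.cross_cross_self h2, hb, zero_smul]
  have key : ∀ t : K, (4 * t) • cross N (cross N a a) (cross N a b)
      + t ^ 2 • ((4 : K) • cross N (cross N a b) (cross N a b)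
        + (2 : K) • cross N (cross N a a) (cross N b b))
      + (4 * t ^ 3) • cross N (cross N b b) (cross N a b) =
      (t * f + t ^ 2 * h) • (a + t • b) := fun t => by
    have e := hN.cross_cross_self h2 (a + t • b)
    rw [show jdet N (a + t • b) = t * f + t ^ 2 * h by
      have := hF 1 t
      rw [one_smul] at this
      rw [this]; ring] at e
    rw [← e]
    simp only [map_add, map_smul, LinearMap.add_apply, LinearMap.smul_apply, cross_comm N b a,
      cross_comm N (cross N a b) (cross N a a), cross_comm N (cross N a b) (cross N b b),
      cross_comm N (cross N b b) (cross N a a), hA, hB]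
    module
  have hM : (4 : K) • cross N (cross N b b) (cross N a b) = h • b := by
    have h12 : (12 : K) ≠ 0 := by
      rw [show (12 : K) = 2 * 2 * 3 by norm_num]
      exact mul_ne_zero (mul_ne_zero h2 h2) h3
    refine smul_right_injective _ h12 ?_
    -- This combination removes the even terms and the linear one, and multiplies the cubic one by
    -- $16-4=12$.
    linear_combination (norm := module) key 2 - key (-2) - (2 : K) • (key 1 - key (-1))
  have hMA : 4 * pairForm N (cross N (cross N b b) (cross N a b)) (cross N a a) = h * f := by
    rw [← smul_eq_mul, ← LinearMap.smul_apply, ← map_smul, hM, map_smul, LinearMap.smul_apply,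
      pairForm_comm, ← hN.three_jD h2 h3, ← hf, smul_eq_mul]
  have hz : pairForm N (cross N (cross N b b) (cross N a a)) (cross N a a) = 0 := by
    rw [hN.pairForm_cross_right h2 h3, hA, map_zero]
  rw [hN.jD_eq h2 h3]
  simp only [map_add, LinearMap.add_apply, cross_comm N b a, hB, hz, map_zero,
    LinearMap.zero_apply]
  intro h0
  refine mul_ne_zero hΔ.2 hΔ.1 ?_
  rw [← hMA]
  have := mul_eq_zero.1 h0
  linear_combination 2 * (this.resolve_left (inv_ne_zero h3))

omit [IsSepClosed K] in
theorem eq_zero_of_jmul_diagUnit (h2 : (2 : K) ≠ 0) (i : Fin 3)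
    {X : J K C} (h : jmul N X (diagUnit K C i) = 0) :
    X.1 i = 0 ∧ X.2 (i + 1) = 0 ∧ X.2 (i + 2) = 0 := by
  have h0 := congrArg (fun Z : J K C => Z.1 i) h
  have h1 := congrArg (fun Z : J K C => Z.2 (i + 1)) h
  have h2 := congrArg (fun Z : J K C => Z.2 (i + 2)) h
  fin_cases i <;> simp_all [jmul, diagUnit, oconj, otr]

omit [IsSepClosed K] in
/-- If the adjoint of a singular element is a nonzero multiple of a diagonal matrix unit, then
the element lives in the complementary diagonal block. -/
theorem IsOctonion.eq_zero_of_cross_self (hN : IsOctonion N) (h2 : (2 : K) ≠ 0) (i : Fin 3)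
    {X : J K C} {a : K} (ha : a ≠ 0) (h : cross N X X = a • diagUnit K C i)
    (hX : jdet N X = 0) : X.1 i = 0 ∧ X.2 (i + 1) = 0 ∧ X.2 (i + 2) = 0 := by
  refine eq_zero_of_jmul_diagUnit (N := N) h2 i ?_
  -- Since $X\circ X^\#=\det(X)e=0$, the element $X$ annihilates the matrix unit.
  have e := hN.jmul_cross_self h2 X
  rw [h, hX, zero_smul, hN.jmul_eq h2] at e
  rw [hN.jmul_eq h2]
  refine smul_right_injective _ ha ?_
  change a • _ = a • (0 : J K C)
  simp only [map_smul, LinearMap.smul_apply, smul_eq_mul] at e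
  rw [smul_zero, ← e]
  module

/-- Over a separably closed field, the group acts transitively on the semistable points. -/
theorem IsOctonion.exists_act_basePt (hN : IsOctonion N) (h2 : (2 : K) ≠ 0)
    (h3 : (3 : K) ≠ 0) {x : V K C} (hx : Delta N x ≠ 0) : ∃ g ∈ G N, act g basePt = x := by
  suffices H : ∃ g ∈ G N, act g x = basePt by
    obtain ⟨g, hg, h⟩ := H
    exact ⟨g⁻¹, inv_mem hg, by rw [← h, act_inv_act]⟩
  obtain ⟨m, hm, ha, hb, hab⟩ := hN.exists_three_roots h2 h3 hx
  set y := act m x with hy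
  have hΔ : Delta N y ≠ 0 := hN.Delta_act_ne_zero h2 h3 hm hx
  have hΔ' : 3 * jD N (y 0) (y 0) (y 1) ≠ 0 ∧ 3 * jD N (y 0) (y 1) (y 1) ≠ 0 := by
    simp only [Delta, binCubic, Cubic.discr, ha, hb] at hΔ
    constructor <;> intro h <;> rw [h] at hΔ <;> simp at hΔ
  have hD := hN.jD_cross_self_ne_zero h2 h3 ha hb hΔ'
  have rk : ∀ {X}, jdet N X = 0 → cross N (cross N X X) (cross N X X) = 0 := fun h => by
    rw [hN.cross_cross_self h2, h, zero_smul]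
  -- The order is dictated by $w$: the adjoints of its second component, of the sum and of its first
  -- component are multiples of the diagonal units at $0$, $1$ and $2$.
  obtain ⟨h, hh, p, q, r, hp, hq, hr⟩ :=
    hN.exists_simultaneous h2 h3 (rk hb) (rk hab) (rk ha) hD
  have hpqr : p ≠ 0 ∧ q ≠ 0 ∧ r ≠ 0 := by
    have e : jD N _ _ _ ≠ 0 := (jD_apply hh _ _ _).symm ▸ mul_ne_zero (mult_ne_zero hh) hD
    rw [hp, hq, hr, hN.jD_eq h2 h3] at e
    refine ⟨?_, ?_, ?_⟩ <;> rintro rfl <;> simp at e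
  obtain ⟨hp0, hq0, hr0⟩ := hpqr
  -- Here $h$ moves adjoints; the elements themselves must be moved by its contragredient $g$, for
  -- which $(gX)^\#=c(g)\,h(X^\#)$.
  obtain ⟨g, hg'⟩ := hN.exists_dual h
  have hg := hN.dual_mem h2 h3 hh hg'
  have hgh : ∀ X Y, pairForm N (h X) (g Y) = pairForm N X Y := fun X Y => by
    rw [pairForm_comm, hg', pairForm_comm]
  have hc := mult_ne_zero hg
  have hcr : ∀ X, cross N (g X) (g X) = mult N g • h (cross N X X) := fun X =>
    hN.cross_apply h2 h3 hg hgh X X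
  have hdet : ∀ {X}, jdet N X = 0 → jdet N (g X) = 0 := fun hX => by
    rw [jdet_apply_of_mem hg, hX, mul_zero]
  obtain ⟨A, hA⟩ : ∃ A, A = g (y 0) := ⟨_, rfl⟩
  obtain ⟨B, hB⟩ : ∃ B, B = g (y 1) := ⟨_, rfl⟩
  have hAA : cross N A A = (mult N g * r) • diagUnit K C 2 := by
    rw [hA, hcr, hr, smul_smul]
  have hBB : cross N B B = (mult N g * p) • diagUnit K C 0 := by
    rw [hB, hcr, hp, smul_smul]
  have hAB : cross N (A + B) (A + B) = (mult N g * q) • diagUnit K C 1 := by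
    rw [hA, hB, ← map_add g, hcr, hq, smul_smul]
  obtain ⟨a1, a2, a3⟩ := hN.eq_zero_of_cross_self h2 2 (mul_ne_zero hc hr0) hAA (hA ▸ hdet ha)
  obtain ⟨b1, b2, b3⟩ := hN.eq_zero_of_cross_self h2 0 (mul_ne_zero hc hp0) hBB (hB ▸ hdet hb)
  obtain ⟨c1, c2, c3⟩ := hN.eq_zero_of_cross_self h2 1 (mul_ne_zero hc hq0) hAB
    (by rw [hA, hB, ← map_add]; exact hdet hab)
  replace a2 : A.2 0 = 0 := a2
  replace a3 : A.2 1 = 0 := a3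
  replace b2 : B.2 1 = 0 := b2
  replace b3 : B.2 2 = 0 := b3
  replace c2 : A.2 2 + B.2 2 = 0 := c2
  replace c3 : A.2 0 + B.2 0 = 0 := c3
  replace c1 : A.1 1 + B.1 1 = 0 := c1
  rw [b3, add_zero] at c2
  rw [a2, zero_add] at c3
  have hAA2 := congrArg (fun Z : J K C => Z.1 2) hAA
  have hBB0 := congrArg (fun Z : J K C => Z.1 0) hBB
  simp only [cross_self_fst N h2, Prod.smul_fst, Pi.smul_apply, diagUnit, Pi.single_eq_same,
    smul_eq_mul, mul_one, c2, c3, QuadraticMap.map_zero, sub_zero, zero_add] at hAA2 hBB0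
  replace hAA2 : A.1 0 * A.1 1 = mult N g * r := hAA2
  have n1 : A.1 0 ≠ 0 ∧ A.1 1 ≠ 0 := by
    rw [← mul_ne_zero_iff, hAA2]; exact mul_ne_zero hc hr0
  have n2 : B.1 1 ≠ 0 ∧ B.1 2 ≠ 0 := by
    rw [← mul_ne_zero_iff, hBB0]; exact mul_ne_zero hc hp0
  have : NeZero (2 : K) := ⟨h2⟩
  -- At this stage $A=\mathrm{diag}(A_0,A_1,0)$ and $B=\mathrm{diag}(0,-A_1,B_2)$. Scaling by
  -- $\mathrm{diag}(r_i)$ multiplies the diagonal entries by $r_i^2$, and square roots exist because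
  -- $2\neq0$.
  obtain ⟨r₀, hr₀⟩ := IsSepClosed.exists_eq_mul_self (A.1 0)⁻¹
  obtain ⟨r₁, hr₁⟩ := IsSepClosed.exists_eq_mul_self (B.1 1)⁻¹
  obtain ⟨r₂, hr₂⟩ := IsSepClosed.exists_eq_mul_self (-(B.1 2)⁻¹)
  have z₀ : r₀ ≠ 0 := by rintro rfl; simp [n1.1] at hr₀
  have z₁ : r₁ ≠ 0 := by rintro rfl; simp [n2.1] at hr₁
  have z₂ : r₂ ≠ 0 := by rintro rfl; simp [n2.2] at hr₂
  obtain ⟨d, hd, hd'⟩ := exists_diag N ![r₀, r₁, r₂] (by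
    intro i; fin_cases i <;> simpa)
  refine ⟨(d * g, 1) * m, mul_mem (mem_G_of_fst (mul_mem hd hg)) hm, ?_⟩
  rw [act_mul, ← hy]
  have eA : d A = basePt 0 := by
    have : A.1 1 = -B.1 1 := eq_neg_of_add_eq_zero_left c1
    rw [hd']
    ext i
    · fin_cases i
      · simp [basePt, pow_two, ← hr₀, n1.1]
      · simp [basePt, pow_two, ← hr₁, this, n2.1]
      · simp [basePt, a1]
    · fin_cases i <;> simp [basePt, a2, a3, c2]
  have eB : d B = basePt 1 := by
    rw [hd']
    ext i
    · fin_cases i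
      · simp [basePt, b1]
      · simp [basePt, pow_two, ← hr₁, n2.1]
      · simp [basePt, pow_two, ← hr₂, n2.2]
    · fin_cases i <;> simp [basePt, b2, b3, c3]
  ext1 i
  rw [act_fst, LinearEquiv.mul_apply]
  fin_cases i
  · exact (congrArg d hA.symm).trans eA
  · exact (congrArg d hB.symm).trans eB

end Transitivity

/-! ### Extension of scalars of octonion algebras. -/

section BaseChange

open QuadraticMap

variable {k : Type u} {C : Type v} [Field k] [NonAssocRing C] [Module k C]
  [SMulCommClass k C C] [IsScalarTower k C C] [Invertible (2 : k)] {N : QuadraticForm k C}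
  (L : Type u) [Field L] [Algebra k L]

theorem extNorm_tmul (N : QuadraticForm k C) (a : L) (x : C) :
    extNorm L N (a ⊗ₜ x) = algebraMap k L (N x) * (a * a) := by
  rw [QuadraticForm.baseChange_tmul, Algebra.smul_def]

theorem polar_extNorm_tmul (N : QuadraticForm k C) (a b : L) (x y : C) :
    polar (extNorm L N) (a ⊗ₜ x) (b ⊗ₜ y) = algebraMap k L (polar N x y) * (a * b) := by
  have : Invertible (2 : L) := (Invertible.map (algebraMap k L) 2).copy 2 (map_ofNat _ _).symm
  have h := LinearMap.congr_fun₂ (QuadraticForm.polarBilin_baseChange (A := L) N) (a ⊗ₜ x) (b ⊗ₜ y)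
  rw [LinearMap.BilinForm.baseChange_tmul, Algebra.smul_def] at h
  exact h.trans (by simp [mul_comm a b])

theorem one_tmul_one : (1 : L ⊗[k] C) = (1 : L) ⊗ₜ[k] (1 : C) := rfl

variable {L}

theorem IsOctonion.polar_mul_mul_extNorm (hN : IsOctonion N) (x y z w : L ⊗[k] C) :
    polar (extNorm L N) (x * y) (z * w) + polar (extNorm L N) (x * w) (z * y) =
      polar (extNorm L N) x z * polar (extNorm L N) y w := by
  induction x using TensorProduct.induction_on with
  | zero => simp
  | add x x' h h' =>
    simp only [add_mul, polar_add_left]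
    linear_combination h + h'
  | tmul a x =>
  induction y using TensorProduct.induction_on with
  | zero => simp
  | add y y' h h' =>
    simp only [mul_add, polar_add_left, polar_add_right]
    linear_combination h + h'
  | tmul b y =>
  induction z using TensorProduct.induction_on with
  | zero => simp
  | add y y' h h' =>
    simp only [add_mul, polar_add_right]
    linear_combination h + h'
  | tmul c z =>
  induction w using TensorProduct.induction_on with
  | zero => simp
  | add y y' h h' =>
    simp only [mul_add, polar_add_left, polar_add_right]
    linear_combination h + h'
  | tmul d w =>
    simp only [Algebra.TensorProduct.tmul_mul_tmul, polar_extNorm_tmul]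
    have h := congrArg (algebraMap k L) (hN.polar_mul_mul x y z w)
    simp only [map_add, map_mul] at h
    linear_combination (a * b * c * d) * h

theorem IsOctonion.extNorm (hN : IsOctonion N) : IsOctonion (extNorm L N) where
  finrank_eq := by rw [Module.finrank_baseChange, hN.finrank_eq]
  nondegenerate x hx := by
    have := hN.finite
    have hr : (polarBilin N).IsRefl := fun x y h => by
      rw [polarBilin_apply_apply] at h ⊢; rwa [polar_comm]
    have hB : (polarBilin N).Nondegenerate :=
      (LinearMap.IsRefl.nondegenerate_iff_separatingLeft hr).2 fun x h => hN.nondegenerate x h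
    let b := Module.finBasis k C
    -- Pairing with the dual basis over $k$ still reads off coordinates over $L$, so nondegeneracy
    -- survives.
    have hz : ∀ (z : L ⊗[k] C) i,
        polar (OctJordan.extNorm L N) z (1 ⊗ₜ LinearMap.BilinForm.dualBasis _ hB b i) =
          (b.baseChange L).repr z i := fun z i => by
      induction z using TensorProduct.induction_on with
      | zero => simp
      | add x y h h' => rw [polar_add_left, h, h', map_add, Finsupp.add_apply]
      | tmul a x =>
        rw [polar_extNorm_tmul, Module.Basis.baseChange_repr_tmul, mul_one, Algebra.smul_def,
          polar_comm]
        congr 2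
        conv_lhs => rw [← b.sum_repr x]
        rw [← polarBilin_apply_apply, map_sum]
        simp only [map_smul, LinearMap.BilinForm.apply_dualBasis_left, smul_eq_mul]
        simp
    refine (b.baseChange L).repr.injective (Finsupp.ext fun i => ?_)
    rw [← hz, hx, map_zero, Finsupp.zero_apply]
  norm_mul x y := by
    have h2 : (2 : L) ≠ 0 := by
      have := (isUnit_of_invertible (2 : k)).ne_zero
      intro h
      exact this ((algebraMap k L).injective (by rw [map_ofNat, h, map_zero]))
    -- On the diagonal the linearized law reads $4N(xy)=4N(x)N(y)$.
    have e := hN.polar_mul_mul_extNorm (L := L) x y x y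
    simp only [polar_self] at e
    refine mul_left_cancel₀ (mul_ne_zero h2 h2) ?_
    linear_combination e

end BaseChange

/-! ### Galois equivariance and fixed points. -/

section Galois

open QuadraticMap

variable {k : Type u} {C : Type v} [Field k] [NonAssocRing C] [Module k C]
  [SMulCommClass k C C] [IsScalarTower k C C] [Invertible (2 : k)] {N : QuadraticForm k C}
  {L : Type u} [Field L] [Algebra k L]

theorem galC_tmul (σ : L ≃ₐ[k] L) (a : L) (x : C) :
    galC σ (a ⊗ₜ[k] x) = σ a ⊗ₜ[k] x := rfl

theorem galC_one (σ : L ≃ₐ[k] L) : galC σ (1 : L ⊗[k] C) = 1 := by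
  rw [one_tmul_one, galC_tmul, map_one]

theorem galC_mul (σ : L ≃ₐ[k] L) (x y : L ⊗[k] C) :
    galC σ (x * y) = galC σ x * galC σ y := by
  induction x using TensorProduct.induction_on with
  | zero => simp
  | add x x' h h' => simp only [add_mul, map_add, h, h']
  | tmul a x =>
  induction y using TensorProduct.induction_on with
  | zero => simp
  | add y y' h h' => simp only [mul_add, map_add, h, h']
  | tmul b y => simp only [Algebra.TensorProduct.tmul_mul_tmul, galC_tmul, map_mul]

theorem polar_galC (N : QuadraticForm k C) (σ : L ≃ₐ[k] L) (x y : L ⊗[k] C) :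
    polar (extNorm L N) (galC σ x) (galC σ y) = σ (polar (extNorm L N) x y) := by
  induction x using TensorProduct.induction_on with
  | zero => simp
  | add x x' h h' => simp only [polar_add_left, map_add, h, h']
  | tmul a x =>
  induction y using TensorProduct.induction_on with
  | zero => simp
  | add y y' h h' => simp only [polar_add_right, map_add, h, h']
  | tmul b y => simp only [galC_tmul, polar_extNorm_tmul, map_mul, AlgEquiv.commutes]

theorem extNorm_galC (N : QuadraticForm k C) (σ : L ≃ₐ[k] L) (x : L ⊗[k] C) :
    extNorm L N (galC σ x) = σ (extNorm L N x) := by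
  induction x using TensorProduct.induction_on with
  | zero => simp
  | add x x' h h' => rw [map_add, map_add_eq, map_add_eq, h, h', polar_galC, map_add, map_add]
  | tmul a x => simp only [galC_tmul, extNorm_tmul, map_mul, AlgEquiv.commutes]

theorem otr_galC (N : QuadraticForm k C) (σ : L ≃ₐ[k] L) (x : L ⊗[k] C) :
    otr (extNorm L N) (galC σ x) = σ (otr (extNorm L N) x) := by
  rw [otr, otr, ← polar_galC, galC_one]

theorem jdet_galJ (N : QuadraticForm k C) (σ : L ≃ₐ[k] L) (X : J L (L ⊗[k] C)) :
    jdet (extNorm L N) (galJ σ X) = σ (jdet (extNorm L N) X) := by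
  simp [jdet, galJ, ← galC_mul, otr_galC, extNorm_galC]

theorem galJ_je (σ : L ≃ₐ[k] L) : galJ σ (je : J L (L ⊗[k] C)) = je := by
  ext i <;> simp [galJ, je]

theorem mult_galGL (N : QuadraticForm k C) (σ : L ≃ₐ[k] L)
    (g : J L (L ⊗[k] C) ≃ₗ[L] J L (L ⊗[k] C)) :
    mult (extNorm L N) (galGL σ g) = σ (mult (extNorm L N) g) := by
  change jdet _ (galJ σ (g (galJ σ.symm je))) = _
  rw [galJ_je, jdet_galJ, mult]

theorem mu_galAmb (N : QuadraticForm k C) (σ : L ≃ₐ[k] L) (g : Amb L (L ⊗[k] C))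
    (X : J L (L ⊗[k] C)) :
    mu (extNorm L N) (galAmb σ g) (galJ σ X) = galJ σ (mu (extNorm L N) g X) := by
  have h : galGL σ g.1 (galJ σ X) = galJ σ (g.1 X) := by
    change galJ σ (g.1 (galJ σ.symm (galJ σ X))) = _
    rw [galJ_galJ σ.symm σ σ.symm_apply_apply]
  have hd : ((galAmb σ g).2 : Matrix (Fin 2) (Fin 2) L).det =
      σ (g.2 : Matrix (Fin 2) (Fin 2) L).det := by
    change ((g.2 : Matrix (Fin 2) (Fin 2) L).map σ).det = _
    simp [Matrix.det_fin_two]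
  rw [mu, mu, galJ_smul, hd, map_mul, map_pow]
  change (mult _ (galGL σ g.1) * _) • galGL σ g.1 (galJ σ X) = _
  rw [h, mult_galGL]

/-- Coordinates in a basis defined over $k$ commute with the Galois action, which reduces the claim
to the fixed field of $L$. -/
theorem galC_fixed [IsGalois k L] [Module.Finite k C] (z : L ⊗[k] C)
    (hz : ∀ σ : L ≃ₐ[k] L, galC σ z = z) : ∃ x : C, z = 1 ⊗ₜ x := by
  let b := Module.finBasis k C
  have hr : ∀ (σ : L ≃ₐ[k] L) (z : L ⊗[k] C) i,
      (b.baseChange L).repr (galC σ z) i = σ ((b.baseChange L).repr z i) := fun σ z i => by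
    induction z using TensorProduct.induction_on with
    | zero => simp
    | add x y h h' => simp only [map_add, Finsupp.add_apply, h, h']
    | tmul a x => simp [galC_tmul, Algebra.smul_def]
  have h : ∀ i, ∃ c : k, algebraMap k L c = (b.baseChange L).repr z i := fun i => by
    refine (InfiniteGalois.mem_range_algebraMap_iff_fixed _).2 fun σ => ?_
    rw [← hr, hz]
  choose c hc using h
  refine ⟨∑ i, c i • b i, ?_⟩
  rw [← (b.baseChange L).sum_repr z, TensorProduct.tmul_sum]
  refine Finset.sum_congr rfl fun i _ => ?_
  rw [← hc, Module.Basis.baseChange_apply, algebraMap_smul, TensorProduct.tmul_smul]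

variable (L)

/-- The inclusion of `J` in `J_L` as a linear map. -/
noncomputable def baseJₗ : J k C →ₗ[k] J L (L ⊗[k] C) :=
  ((Algebra.linearMap k L).compLeft (Fin 3)).prodMap
    ((TensorProduct.mk k L C 1).compLeft (Fin 3))

theorem baseJₗ_apply (X : J k C) : baseJₗ L X = baseJ L X := rfl

theorem isBaseChange_baseJₗ : IsBaseChange L (baseJₗ (k := k) (C := C) L) :=
  IsBaseChange.prodMap _ _ (IsBaseChange.finitePow _ (IsBaseChange.linearMap k L))
    (IsBaseChange.finitePow _ (TensorProduct.isBaseChange k C L))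

theorem baseJ_injective : Function.Injective (baseJₗ (k := k) (C := C) L) :=
  Function.Injective.prodMap ((algebraMap k L).injective.comp_left)
    ((Module.FaithfullyFlat.tensorProduct_mk_injective C).comp_left)

variable {L}

theorem galJ_baseJ (σ : L ≃ₐ[k] L) (X : J k C) : galJ σ (baseJ L X) = baseJ L X := by
  ext i <;> simp [galJ, baseJ, galC_tmul]

theorem galJ_fixed [IsGalois k L] [Module.Finite k C] (Z : J L (L ⊗[k] C)) :
    (∀ σ : L ≃ₐ[k] L, galJ σ Z = Z) ↔ ∃ X : J k C, baseJ L X = Z := by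
  constructor
  · intro h
    have h1 : ∀ i, ∃ c : k, algebraMap k L c = Z.1 i := fun i =>
      (InfiniteGalois.mem_range_algebraMap_iff_fixed _).2 fun σ =>
        congrArg (fun Z : J L (L ⊗[k] C) => Z.1 i) (h σ)
    have h2 : ∀ i, ∃ x : C, Z.2 i = 1 ⊗ₜ x := fun i =>
      galC_fixed _ fun σ => congrArg (fun Z : J L (L ⊗[k] C) => Z.2 i) (h σ)
    choose c hc using h1
    choose x hx using h2
    exact ⟨(c, x), by ext i <;> simp [baseJ, hc, hx]⟩
  · rintro ⟨X, rfl⟩ σ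
    exact galJ_baseJ σ X

theorem extNorm_one_tmul (N : QuadraticForm k C) (x : C) :
    extNorm L N (1 ⊗ₜ x) = algebraMap k L (N x) := by
  rw [extNorm_tmul, mul_one, mul_one]

theorem polar_extNorm_one_tmul (N : QuadraticForm k C) (x y : C) :
    polar (extNorm L N) (1 ⊗ₜ x) (1 ⊗ₜ y) = algebraMap k L (polar N x y) := by
  rw [polar_extNorm_tmul, mul_one, mul_one]

theorem otr_one_tmul (N : QuadraticForm k C) (x : C) :
    otr (extNorm L N) (1 ⊗ₜ x) = algebraMap k L (otr N x) :=
  polar_extNorm_one_tmul N x 1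

theorem oconj_one_tmul (N : QuadraticForm k C) (x : C) :
    oconj (extNorm L N) (1 ⊗ₜ x) = 1 ⊗ₜ oconj N x := by
  rw [oconj, oconj, otr_one_tmul, one_tmul_one, TensorProduct.tmul_sub, TensorProduct.tmul_smul,
    algebraMap_smul]

theorem jdet_baseJ (N : QuadraticForm k C) (X : J k C) :
    jdet (extNorm L N) (baseJ L X) = algebraMap k L (jdet N X) := by
  simp only [jdet, baseJ, Algebra.TensorProduct.tmul_mul_tmul, mul_one, otr_one_tmul,
    extNorm_one_tmul, map_sub, map_add, map_mul, map_sum]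

theorem cross_baseJ (N : QuadraticForm k C) (X Y : J k C) :
    cross (extNorm L N) (baseJ L X) (baseJ L Y) = baseJ L (cross N X Y) := by
  have h : (2 : L)⁻¹ = algebraMap k L 2⁻¹ := by rw [map_inv₀, map_ofNat]
  ext i
  · simp only [cross_fst, baseJ, polar_extNorm_one_tmul, h, map_sub, map_add, map_mul]
  · simp only [cross_snd, baseJ, Algebra.TensorProduct.tmul_mul_tmul, mul_one, h,
      ← TensorProduct.tmul_add, oconj_one_tmul, algebraMap_smul, ← TensorProduct.tmul_smul,
      ← TensorProduct.tmul_sub]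

theorem pairForm_baseJ (N : QuadraticForm k C) (X Y : J k C) :
    pairForm (extNorm L N) (baseJ L X) (baseJ L Y) = algebraMap k L (pairForm N X Y) := by
  simp [pairForm_apply, baseJ, polar_extNorm_one_tmul]

end Galois

/-! ### The homomorphism $\mu$ and the stabilizer of $w$. -/

section Mu

variable {K : Type u} {C : Type v} [Field K] [NonAssocRing C] [Module K C]
  [SMulCommClass K C C] [IsScalarTower K C C] {N : QuadraticForm K C}

theorem mu_mul {g : Amb K C} (hg : g ∈ G N) (h : Amb K C) (X : J K C) :
    mu N (g * h) X = mu N g (mu N h X) := by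
  have hm : mult N (g * h).1 = mult N g.1 * mult N h.1 := mult_mul hg.1
  rw [mu, mu, mu, hm, Prod.snd_mul, Units.val_mul, Matrix.det_mul, Prod.fst_mul,
    LinearEquiv.mul_apply, map_smul]
  module

theorem mu_one (N : QuadraticForm K C) (X : J K C) : mu N (1 : Amb K C) X = X := by
  simp [mu, mult, jdet_je]

theorem mu_inv_mu {g : Amb K C} (hg : g ∈ G N) (X : J K C) : mu N g⁻¹ (mu N g X) = X := by
  rw [← mu_mul (inv_mem hg), inv_mul_cancel, mu_one]

theorem mu_mu_inv {g : Amb K C} (hg : g ∈ G N) (X : J K C) : mu N g (mu N g⁻¹ X) = X := by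
  rw [← mu_mul hg, mul_inv_cancel, mu_one]

/-- `μ_g` as a linear automorphism of `J`. -/
noncomputable def muEquiv {g : Amb K C} (hg : g ∈ G N) : J K C ≃ₗ[K] J K C where
  toFun := mu N g
  invFun := mu N g⁻¹
  map_add' X Y := by simp only [mu, map_add, smul_add]
  map_smul' a X := by simp only [mu, map_smul, RingHom.id_apply]; module
  left_inv := mu_inv_mu hg
  right_inv := mu_mu_inv hg

theorem IsOctonion.jmul_je (hN : IsOctonion N) (h2 : (2 : K) ≠ 0) (X : J K C) :
    jmul N X je = X := by
  rw [hN.jmul_eq h2, cross_comm, cross_je, pairForm_je_je]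
  match_scalars <;> field_simp <;> norm_num

theorem IsOctonion.je_jmul (hN : IsOctonion N) (h2 : (2 : K) ≠ 0) (X : J K C) :
    jmul N je X = X := by
  rw [hN.jmul_eq h2, cross_je, pairForm_je_je, pairForm_comm N je]
  match_scalars <;> field_simp <;> norm_num

/-- The unit and the two components of $w$ span the diagonal matrices, so control of these three
elements is control of the diagonal subalgebra. -/
theorem eq_basePt_comb (h3 : (3 : K) ≠ 0) (X : J K C) (hX : X.2 = 0) :
    ∃ a b c : K, X = a • je + b • basePt 0 + c • basePt 1 := by
  refine ⟨3⁻¹ * (X.1 0 + X.1 1 + X.1 2), X.1 0 - 3⁻¹ * (X.1 0 + X.1 1 + X.1 2),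
    3⁻¹ * (X.1 0 + X.1 1 + X.1 2) - X.1 2, ?_⟩
  ext i
  · fin_cases i <;>
      simp [je, basePt, -Matrix.smul_cons, -Matrix.add_cons] <;>
      field_simp <;> ring
  · simp [je, basePt, hX]

theorem basePt_snd (i : Fin 2) : (basePt i : J K C).2 = 0 := by
  fin_cases i <;> rfl

theorem fst_basePt {g : Amb K C} {x : V K C} (h : act g basePt = x) (i : Fin 2) :
    g.1 (basePt i) = (g⁻¹.2 : Matrix (Fin 2) (Fin 2) K) i 0 • x 0
      + (g⁻¹.2 : Matrix (Fin 2) (Fin 2) K) i 1 • x 1 := by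
  have e : (basePt i : J K C) = act g⁻¹ x i := by rw [← h, act_inv_act]
  have e' : ∀ X, g.1 (g⁻¹.1 X) = X := fun X => g.1.apply_symm_apply X
  rw [e, act_apply, map_add, map_smul, map_smul, e', e']

theorem IsOctonion.mu_jmul (hN : IsOctonion N) (h2 : (2 : K) ≠ 0) (h3 : (3 : K) ≠ 0)
    {h : Amb K C} (hh : h ∈ G N) (hw : act h basePt = basePt) (X Y : J K C) :
    mu N h (jmul N X Y) = jmul N (mu N h X) (mu N h Y) := by
  have e := hN.mu_prodAt h2 h3 hh (x := basePt)
    (by rw [hN.Delta_basePt h2 h3]; exact one_ne_zero) X Y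
  rwa [hw, hN.prodAt_basePt h2 h3, hN.prodAt_basePt h2 h3] at e

/-- As an automorphism, $\mu_h$ fixes the unit; as $h$ fixes $w$, its first factor preserves the
span of the components of $w$. Together these span the diagonal. -/
theorem IsOctonion.mu_snd_eq_zero (hN : IsOctonion N) (h2 : (2 : K) ≠ 0) (h3 : (3 : K) ≠ 0)
    {h : Amb K C} (hh : h ∈ G N) (hw : act h basePt = basePt) {X : J K C} (hX : X.2 = 0) :
    (mu N h X).2 = 0 := by
  have he : mu N h je = je := by
    have e := hN.mu_jmul h2 h3 hh hw je (mu N h⁻¹ je)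
    rwa [hN.je_jmul h2, mu_mu_inv hh, hN.jmul_je h2, eq_comm] at e
  have hb : ∀ i, (mu N h (basePt i)).2 = 0 := fun i => by
    rw [mu, fst_basePt hw]
    simp [basePt_snd]
  obtain ⟨a, b, c, rfl⟩ := eq_basePt_comb h3 X hX
  change (muEquiv hh (a • je + b • basePt 0 + c • basePt 1)).2 = 0
  rw [map_add, map_add, map_smul, map_smul, map_smul]
  change (a • mu N h je + b • mu N h (basePt 0) + c • mu N h (basePt 1)).2 = 0
  rw [he, Prod.snd_add, Prod.snd_add, Prod.smul_snd, Prod.smul_snd, Prod.smul_snd, hb, hb]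
  simp [je]

theorem IsOctonion.mu_snd_eq_zero_iff (hN : IsOctonion N) (h2 : (2 : K) ≠ 0)
    (h3 : (3 : K) ≠ 0) {h : Amb K C} (hh : h ∈ G N) (hw : act h basePt = basePt) (X : J K C) :
    (mu N h X).2 = 0 ↔ X.2 = 0 := by
  refine ⟨fun H => ?_, hN.mu_snd_eq_zero h2 h3 hh hw⟩
  have hw' : act h⁻¹ (basePt : V K C) = basePt := by
    conv_lhs => rw [← hw]
    exact act_inv_act h _
  have := hN.mu_snd_eq_zero h2 h3 (inv_mem hh) hw' H
  rwa [mu_inv_mu hh] at this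

/-- `M_x` is an isotope of `J`. -/
theorem IsOctonion.prodAt_eq (hN : IsOctonion N) (h2 : (2 : K) ≠ 0) (h3 : (3 : K) ≠ 0)
    (x : V K C) (X Y : J K C) :
    prodAt N x X Y = isotopeMul N ((9 * (Delta N x)⁻¹) • hess N x) X Y := by
  rw [prodAt, hN.S_eq h2 h3, hN.isotopeMul_eq h2 h3, hN.isotopeMul_eq h2 h3]
  simp only [map_smul, LinearMap.smul_apply, smul_eq_mul]
  module

end Mu

/-! ### The embedding of $M_x$ in $J$ over the separable closure. -/

section Descent

variable {k : Type u} {C : Type v} [Field k] [NonAssocRing C] [Module k C]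
  [SMulCommClass k C C] [IsScalarTower k C C] [Invertible (2 : k)] {N : QuadraticForm k C}
  {L : Type u} [Field L] [Algebra k L]

theorem two_ne_zero_of_invertible (k L : Type*) [Field k] [Invertible (2 : k)] [Field L]
    [Algebra k L] : (2 : L) ≠ 0 := by
  rw [← map_ofNat (algebraMap k L)]
  exact (map_ne_zero _).2 (isUnit_of_invertible (2 : k)).ne_zero

theorem jD_baseJ (N : QuadraticForm k C) (X Y Z : J k C) :
    jD (extNorm L N) (baseJ L X) (baseJ L Y) (baseJ L Z) = algebraMap k L (jD N X Y Z) := by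
  have h : (6 : L)⁻¹ = algebraMap k L 6⁻¹ := by rw [map_inv₀, map_ofNat]
  simp only [jD, ← baseJₗ_apply, ← map_add]
  simp only [baseJₗ_apply, jdet_baseJ, h, ← map_add, ← map_sub, ← map_mul]

theorem Delta_baseV (N : QuadraticForm k C) (x : V k C) :
    Delta (extNorm L N) (baseV L x) = algebraMap k L (Delta N x) := by
  simp only [Delta, binCubic, Cubic.discr, baseV, jdet_baseJ, jD_baseJ, map_add, map_sub, map_mul,
    map_pow, map_ofNat]

theorem baseJ_smul (a : k) (X : J k C) : baseJ L (a • X) = algebraMap k L a • baseJ L X := by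
  rw [← baseJₗ_apply, map_smul, algebraMap_smul, baseJₗ_apply]

theorem hess_baseV (N : QuadraticForm k C) (x : V k C) :
    hess (extNorm L N) (baseV L x) = baseJ L (hess N x) := by
  simp only [hess, baseV, jD_baseJ, cross_baseJ]
  simp only [← baseJₗ_apply, map_add, map_sub, map_smul]
  simp only [← algebraMap_smul L (_ : k) (baseJₗ L _), map_mul, map_sub, map_pow, map_ofNat]

theorem IsOctonion.prodAt_baseJ (hN : IsOctonion N) (h3 : (3 : k) ≠ 0) (x : V k C)
    (X Y : J k C) :
    prodAt (OctJordan.extNorm L N) (baseV L x) (baseJ L X) (baseJ L Y) =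
      baseJ L (prodAt N x X Y) := by
  have h2 : (2 : k) ≠ 0 := (isUnit_of_invertible (2 : k)).ne_zero
  have h3' : (3 : L) ≠ 0 := by
    rw [← map_ofNat (algebraMap k L)]; exact (map_ne_zero _).2 h3
  rw [hN.extNorm.prodAt_eq (two_ne_zero_of_invertible k L) h3', hN.prodAt_eq h2 h3,
    hN.extNorm.isotopeMul_eq (two_ne_zero_of_invertible k L) h3', hN.isotopeMul_eq h2 h3,
    hess_baseV, Delta_baseV,
    show (9 : L) * (algebraMap k L (Delta N x))⁻¹ = algebraMap k L (9 * (Delta N x)⁻¹) by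
      rw [map_mul, map_inv₀, map_ofNat],
    ← baseJ_smul, cross_baseJ, cross_baseJ, pairForm_baseJ, pairForm_baseJ, ← baseJ_smul,
    ← baseJ_smul, show (2 : L) = algebraMap k L 2 from (map_ofNat _ 2).symm, ← map_inv₀,
    ← baseJ_smul]
  simp only [← baseJₗ_apply]
  rw [← map_add]
  simp only [baseJₗ_apply]
  rw [← baseJ_smul]
  simp only [← baseJₗ_apply, ← map_sub]

/-- The embedding of `M_x` in `J_L` that is given by a point `g` with `g w = x`. -/
noncomputable def descentMap {g : Amb L (L ⊗[k] C)} (hg : g ∈ G (extNorm L N)) :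
    J k C →ₗ[k] J L (L ⊗[k] C) :=
  ((muEquiv hg).symm.toLinearMap.restrictScalars k) ∘ₗ baseJₗ L

theorem descentMap_apply {g : Amb L (L ⊗[k] C)} (hg : g ∈ G (extNorm L N)) (X : J k C) :
    descentMap hg X = mu (extNorm L N) g⁻¹ (baseJ L X) := rfl

theorem isBaseChange_descentMap {g : Amb L (L ⊗[k] C)} (hg : g ∈ G (extNorm L N)) :
    IsBaseChange L (descentMap hg) :=
  IsBaseChange.of_equiv ((isBaseChange_baseJₗ L).equiv ≪≫ₗ (muEquiv hg).symm) fun X => by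
    rw [LinearEquiv.trans_apply, IsBaseChange.equiv_tmul, one_smul]
    rfl

theorem descentMap_injective {g : Amb L (L ⊗[k] C)} (hg : g ∈ G (extNorm L N)) :
    Function.Injective (descentMap hg) :=
  (muEquiv hg).symm.injective.comp (baseJ_injective L)

theorem IsOctonion.descentMap_prodAt (hN : IsOctonion N) (h3 : (3 : k) ≠ 0)
    {g : Amb L (L ⊗[k] C)} (hg : g ∈ G (OctJordan.extNorm L N)) {x : V k C}
    (hx : Delta N x ≠ 0) (hgx : act g basePt = baseV L x) (X Y : J k C) :
    descentMap hg (prodAt N x X Y) =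
      jmul (OctJordan.extNorm L N) (descentMap hg X) (descentMap hg Y) := by
  have h3' : (3 : L) ≠ 0 := by
    rw [← map_ofNat (algebraMap k L)]; exact (map_ne_zero _).2 h3
  have h2' := two_ne_zero_of_invertible k L
  rw [descentMap_apply, ← hN.prodAt_baseJ h3, hN.extNorm.mu_prodAt h2' h3' (inv_mem hg)
    (by rw [Delta_baseV]; exact (map_ne_zero _).2 hx), ← hgx, act_inv_act,
    hN.extNorm.prodAt_basePt h2' h3']
  rfl

/-- The cocycle is a coboundary in $GL(J_L)$: applying $\mu_g$ turns the twisted condition on $Z$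
into ordinary Galois invariance of $\mu_gZ$. -/
theorem IsOctonion.forall_galois_iff (hN : IsOctonion N) [IsGalois k L]
    {g : Amb L (L ⊗[k] C)} (hg : g ∈ G (OctJordan.extNorm L N)) (Z : J L (L ⊗[k] C)) :
    (∀ σ : L ≃ₐ[k] L, mu (OctJordan.extNorm L N) (g⁻¹ * galAmb σ g) (galJ σ Z) = Z) ↔
      ∃ X : J k C, baseJ L X = mu (OctJordan.extNorm L N) g Z := by
  have := hN.finite
  rw [← galJ_fixed]
  refine forall_congr' fun σ => ?_
  rw [mu_mul (inv_mem hg), mu_galAmb]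
  constructor
  · intro h
    conv_rhs => rw [← h]
    rw [mu_mu_inv hg]
  · intro h
    rw [h, mu_inv_mu hg]

/-- The image of the unit of `J` in `M_x` is rational. -/
theorem IsOctonion.exists_unit (hN : IsOctonion N) (h3 : (3 : k) ≠ 0)
    {g : Amb L (L ⊗[k] C)} (hg : g ∈ G (OctJordan.extNorm L N)) {x : V k C}
    (hgx : act g basePt = baseV L x) : ∃ X : J k C, descentMap hg X = je := by
  have h3' : (3 : L) ≠ 0 := by
    rw [← map_ofNat (algebraMap k L)]; exact (map_ne_zero _).2 h3
  have h2' := two_ne_zero_of_invertible k L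
  have hL := hN.extNorm (L := L)
  obtain ⟨g', hg'⟩ := hL.exists_dual g.1
  have hc := mult_ne_zero hg.1
  have hd := det_ne_zero g.2
  have h9 : (9 : L) ≠ 0 := by
    rw [show (9 : L) = 3 * 3 by norm_num]; exact mul_ne_zero h3' h3'
  have ee : cross (OctJordan.extNorm L N) je je = je := by
    rw [cross_je, pairForm_je_je]
    match_scalars
    field_simp
    norm_num
  -- The unit of $J^{(a)}$ is $a^{-1}=\det(a)^{-1}a^\#$. Here $a=9\Delta(x)^{-1}h_x$ has determinant
  -- $\Delta(x)^{-1}$, so $a^{-1}=81\,\Delta(x)^{-1}h_x^\#$.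
  refine ⟨(81 * (Delta N x)⁻¹) • cross N (hess N x) (hess N x), ?_⟩
  have e : baseJ L ((81 * (Delta N x)⁻¹) • cross N (hess N x) (hess N x)) =
      mu (OctJordan.extNorm L N) g je := by
    rw [baseJ_smul, ← cross_baseJ, ← hess_baseV, map_mul, map_inv₀, ← Delta_baseV, ← hgx,
      hL.hess_act h2' h3' hg hg', hL.Delta_act h2' h3' hg, hL.Delta_basePt h2' h3',
      hL.hess_basePt h2' h3']
    simp only [map_smul, LinearMap.smul_apply, hL.cross_dual h2' h3' hg.1 hg', ee, mu,
      map_ofNat]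
    match_scalars
    field_simp
    norm_num
  rw [descentMap_apply, e, mu_inv_mu hg]

/-- The components of $x$ themselves lie in $n_x$; this supplies the rational elements from which
the diagonal is spanned. -/
theorem descentMap_point {g : Amb L (L ⊗[k] C)} (hg : g ∈ G (extNorm L N)) {x : V k C}
    (hgx : act g basePt = baseV L x) (i : Fin 2) : (descentMap hg (x i)).2 = 0 := by
  have e : baseJ L (x i) = act g basePt i := by rw [hgx]; rfl
  have e' : ∀ X, g⁻¹.1 (g.1 X) = X := fun X => g.1.symm_apply_apply X
  rw [descentMap_apply, e, mu, act_apply, map_add, map_smul, map_smul, e', e']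
  simp [basePt_snd]

theorem basePt_mem_span {g : Amb L (L ⊗[k] C)} (hg : g ∈ G (extNorm L N)) {x : V k C}
    (hgx : act g basePt = baseV L x) (i : Fin 2) :
    ∃ a b : L, basePt i = a • descentMap hg (x 0) + b • descentMap hg (x 1) := by
  have hc : mult (extNorm L N) g⁻¹.1 *
      (g⁻¹.2 : Matrix (Fin 2) (Fin 2) L).det ^ 2 ≠ 0 :=
    mul_ne_zero (mult_ne_zero (inv_mem hg).1) (pow_ne_zero _ (det_ne_zero g⁻¹.2))
  have e : (basePt i : J L (L ⊗[k] C)) = act g⁻¹ (baseV L x) i := by rw [← hgx, act_inv_act]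
  set c := mult (extNorm L N) g⁻¹.1 * (g⁻¹.2 : Matrix (Fin 2) (Fin 2) L).det ^ 2 with hc'
  refine ⟨(g⁻¹.2 : Matrix (Fin 2) (Fin 2) L) i 0 * c⁻¹,
    (g⁻¹.2 : Matrix (Fin 2) (Fin 2) L) i 1 * c⁻¹, ?_⟩
  rw [e, act_apply, descentMap_apply, descentMap_apply, mu, mu, ← hc', smul_smul, smul_smul,
    inv_mul_cancel_right₀ hc, inv_mul_cancel_right₀ hc]
  rfl

end Descent

/-! ### The cubic étale subalgebra and the uniqueness of the pair. -/

section Diagonal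

variable {K : Type u} {C : Type v} [Field K] [NonAssocRing C] [Module K C]
  [SMulCommClass K C C] [IsScalarTower K C C]

theorem jmul_diag {N : QuadraticForm K C} (d d' : Fin 3 → K) :
    jmul N ((d, 0) : J K C) (d', 0) = (d * d', 0) := by
  ext i <;> fin_cases i <;> simp [jmul, oconj, otr]

end Diagonal

section Etale

variable {k : Type u} {C : Type v} [Field k] [NonAssocRing C] [Module k C]
  [SMulCommClass k C C] [IsScalarTower k C C] [Invertible (2 : k)] {N : QuadraticForm k C}
  {L : Type u} [Field L] [Algebra k L]

/-- A `k`-subalgebra `E` of `L³` with `L ⊗ E = L³` is cubic étale. -/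
theorem etale_of_bijective (E : Subalgebra k (Fin 3 → L))
    (h : Function.Bijective (Algebra.TensorProduct.lift (Algebra.ofId L (Fin 3 → L)) E.val
      fun _ _ => Commute.all _ _)) : Algebra.Etale k E ∧ Module.finrank k E = 3 := by
  let e := AlgEquiv.ofBijective _ h
  constructor
  · have : Algebra.Etale L (L ⊗[k] E) := Algebra.Etale.of_equiv e.symm
    exact Algebra.Etale.of_etale_tensorProduct_of_faithfullyFlat L
  · rw [← Module.finrank_baseChange (R := L), e.toLinearEquiv.finrank_eq,
      Module.finrank_fin_fun]

/-- The subspace of `M_x` that becomes the space of diagonal matrices over `L`. -/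
noncomputable def diagSubmodule {g : Amb L (L ⊗[k] C)} (hg : g ∈ G (extNorm L N)) :
    Submodule k (J k C) :=
  LinearMap.ker (LinearMap.snd k (Fin 3 → L) (Fin 3 → L ⊗[k] C) ∘ₗ descentMap hg)

theorem mem_diagSubmodule {g : Amb L (L ⊗[k] C)} (hg : g ∈ G (extNorm L N)) (X : J k C) :
    X ∈ diagSubmodule hg ↔ (descentMap hg X).2 = 0 := Iff.rfl

theorem IsOctonion.isCubicEtale_diagSubmodule (hN : IsOctonion N) (h3 : (3 : k) ≠ 0)
    {g : Amb L (L ⊗[k] C)} (hg : g ∈ G (OctJordan.extNorm L N)) {x : V k C}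
    (hx : Delta N x ≠ 0) (hgx : act g basePt = baseV L x) :
    IsCubicEtale (prodAt N x) (diagSubmodule hg) := by
  have h2' := two_ne_zero_of_invertible k L
  have h3' : (3 : L) ≠ 0 := by
    rw [← map_ofNat (algebraMap k L)]; exact (map_ne_zero _).2 h3
  have hL := hN.extNorm (L := L)
  obtain ⟨u, hu⟩ := hN.exists_unit h3 hg hgx
  have hinj := descentMap_injective hg
  have hmul := hN.descentMap_prodAt h3 hg hx hgx
  -- The subalgebra is realized inside $L^3$, where commutativity and associativity come for free.
  let E : Subalgebra k (Fin 3 → L) :=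
    { carrier := {d | ∃ X, descentMap hg X = (d, 0)}
      mul_mem' := by
        rintro d d' ⟨X, hX⟩ ⟨Y, hY⟩
        exact ⟨prodAt N x X Y, by rw [hmul, hX, hY, jmul_diag]⟩
      add_mem' := by
        rintro d d' ⟨X, hX⟩ ⟨Y, hY⟩
        exact ⟨X + Y, by rw [map_add, hX, hY, Prod.mk_add_mk, add_zero]⟩
      algebraMap_mem' := fun a => ⟨a • u, by
        rw [map_smul, hu]
        ext i
        · simp [je, Algebra.smul_def]
        · simp [je]⟩ }
  let j : diagSubmodule hg →ₗ[k] E :=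
    { toFun := fun X => ⟨(descentMap hg X).1, X, Prod.ext rfl X.2⟩
      map_add' := fun X Y => by ext; simp
      map_smul' := fun a X => by ext; simp }
  have hj : Function.Bijective j := by
    constructor
    · intro X Y h
      refine Subtype.ext (hinj (Prod.ext (congrArg Subtype.val h) ?_))
      exact ((mem_diagSubmodule hg X).1 X.2).trans ((mem_diagSubmodule hg Y).1 Y.2).symm
    · rintro ⟨d, X, hX⟩
      exact ⟨⟨X, congrArg Prod.snd hX⟩, Subtype.ext (congrArg Prod.fst hX)⟩
  let e := LinearEquiv.ofBijective j hj
  let ι : E →ₗ[k] J k C := (diagSubmodule hg).subtype ∘ₗ e.symm.toLinearMap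
  have hι : ∀ d : E, descentMap hg (ι d) = ((d : Fin 3 → L), 0) := fun d => by
    have h := congrArg Subtype.val (e.apply_symm_apply d)
    exact Prod.ext h (e.symm d).2
  have hιinj : Function.Injective ι := (Submodule.subtype_injective _).comp e.symm.injective
  have hrange : LinearMap.range ι = diagSubmodule hg := by
    rw [LinearMap.range_comp, LinearEquiv.range, Submodule.map_top, Submodule.range_subtype]
  let f := Algebra.TensorProduct.lift (Algebra.ofId L (Fin 3 → L)) E.val
      fun _ _ => Commute.all _ _
  have hf : ∀ a d, f (a ⊗ₜ d) = a • (d : Fin 3 → L) := fun a d => by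
    rw [Algebra.TensorProduct.lift_tmul, Algebra.smul_def]; rfl
  have hbij : Function.Bijective f := by
    constructor
    -- Injectivity: $L\otimes E\to L\otimes M_x$ is injective by flatness, and $L\otimes M_x\cong
    -- J_L$.
    · have hcomm : ∀ z, ((f z, 0) : J L (L ⊗[k] C)) =
          (isBaseChange_descentMap hg).equiv (ι.baseChange L z) := fun z => by
        induction z using TensorProduct.induction_on with
        | zero => simp
        | add z z' h h' => rw [map_add, map_add, map_add, ← h, ← h', Prod.mk_add_mk, add_zero]
        | tmul a d =>
          rw [hf, LinearMap.baseChange_tmul, IsBaseChange.equiv_tmul, hι, Prod.smul_mk, smul_zero]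
      have hflat : Function.Injective (ι.baseChange L) :=
        Module.Flat.lTensor_preserves_injective_linearMap (M := L) ι hιinj
      intro z z' h
      refine hflat ((isBaseChange_descentMap hg).equiv.injective ?_)
      rw [← hcomm, ← hcomm, h]
    -- Surjectivity: the image is an $L$-subalgebra that contains $1$ and the images of $x_1,x_2$,
    -- whose span contains the components of $w$.
    · intro d
      have hmem : ∀ X : J k C, (descentMap hg X).2 = 0 → (descentMap hg X).1 ∈ f.range :=
        fun X hX => ⟨1 ⊗ₜ ⟨_, X, Prod.ext rfl hX⟩, by
          change f _ = _
          rw [hf, one_smul]⟩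
      have hb : ∀ i, (basePt i : J L (L ⊗[k] C)).1 ∈ f.range := fun i => by
        obtain ⟨a, b, h⟩ := basePt_mem_span hg hgx i
        rw [h]
        exact add_mem (Subalgebra.smul_mem _ (hmem _ (descentMap_point hg hgx 0)) a)
          (Subalgebra.smul_mem _ (hmem _ (descentMap_point hg hgx 1)) b)
      obtain ⟨a, b, c, h⟩ := eq_basePt_comb h3' ((d, 0) : J L (L ⊗[k] C)) rfl
      have hd : d = a • (je : J L (L ⊗[k] C)).1 + b • (basePt 0 : J L (L ⊗[k] C)).1
          + c • (basePt 1 : J L (L ⊗[k] C)).1 := congrArg Prod.fst h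
      have : d ∈ f.range := by
        rw [hd]
        exact add_mem (add_mem (Subalgebra.smul_mem _ (one_mem f.range) a)
          (Subalgebra.smul_mem _ (hb 0) b)) (Subalgebra.smul_mem _ (hb 1) c)
      exact this
  obtain ⟨het, hfr⟩ := etale_of_bijective E hbij
  have hι1 : descentMap hg (ι 1) = je := hι 1
  refine ⟨E, inferInstance, inferInstance, het, hfr, ι, hιinj, hrange, fun a b => hinj ?_,
    fun X => ⟨hinj ?_, hinj ?_⟩⟩
  · rw [hmul, hι, hι, hι, jmul_diag]; rfl
  · rw [hmul, hι1, hL.je_jmul h2']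
  · rw [hmul, hι1, hL.jmul_je h2']

theorem IsOctonion.isJIC_diagSubmodule (hN : IsOctonion N) (h3 : (3 : k) ≠ 0)
    {g : Amb L (L ⊗[k] C)} (hg : g ∈ G (OctJordan.extNorm L N)) {x : V k C}
    (hx : Delta N x ≠ 0) (hgx : act g basePt = baseV L x) :
    IsJIC N (prodAt N x) (diagSubmodule hg) := by
  have h2 : (2 : k) ≠ 0 := (isUnit_of_invertible (2 : k)).ne_zero
  have h2' := two_ne_zero_of_invertible k L
  have h3' : (3 : L) ≠ 0 := by
    rw [← map_ofNat (algebraMap k L)]; exact (map_ne_zero _).2 h3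
  have h9 : (9 : k) ≠ 0 := by
    rw [show (9 : k) = 3 * 3 by norm_num]; exact mul_ne_zero h3 h3
  have h9' : (9 : L) ≠ 0 := by
    rw [show (9 : L) = 3 * 3 by norm_num]; exact mul_ne_zero h3' h3'
  have hL := hN.extNorm (L := L)
  refine ⟨⟨(9 * (Delta N x)⁻¹) • hess N x, ?_, LinearEquiv.refl k _,
    fun X Y => hN.prodAt_eq h2 h3 x X Y⟩, hN.isCubicEtale_diagSubmodule h3 hg hx hgx⟩
  rw [jdet_smul]
  refine mul_ne_zero (pow_ne_zero _ (mul_ne_zero h9 (inv_ne_zero hx))) ?_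
  obtain ⟨g', hg'⟩ := hL.exists_dual g.1
  rw [← map_ne_zero (algebraMap k L), ← jdet_baseJ, ← hess_baseV, ← hgx,
    hL.hess_act h2' h3' hg hg', jdet_smul, hL.jdet_dual h2' h3' hg.1 hg',
    hL.hess_basePt h2' h3', jdet_smul, jdet_je]
  have hc := mult_ne_zero hg.1
  have hd := det_ne_zero g.2
  simp [hc, hd, h9']

theorem IsOctonion.pairEquiv_of_descent (hN : IsOctonion N) (h3 : (3 : k) ≠ 0) [IsGalois k L]
    {g g' : Amb L (L ⊗[k] C)} (hg : g ∈ G (OctJordan.extNorm L N))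
    (hg' : g' ∈ G (OctJordan.extNorm L N)) {x : V k C} (hx : Delta N x ≠ 0)
    (hgx : act g basePt = baseV L x) (hgx' : act g' basePt = baseV L x)
    {M : Type w} [AddCommGroup M] [Module k M] {m : M → M → M} {n : Submodule k M}
    (φ : M →ₗ[k] J L (L ⊗[k] C)) (hφ : Function.Injective φ)
    (hr : ∀ Z, Z ∈ LinearMap.range φ ↔ ∀ σ : L ≃ₐ[k] L,
      mu (OctJordan.extNorm L N) (g'⁻¹ * galAmb σ g') (galJ σ Z) = Z)
    (hm : ∀ X Y, φ (m X Y) = jmul (OctJordan.extNorm L N) (φ X) (φ Y))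
    (hn : ∀ X, X ∈ n ↔ (φ X).2 = 0) :
    PairEquiv m n (prodAt N x) (diagSubmodule hg) := by
  have h2' := two_ne_zero_of_invertible k L
  have h3' : (3 : L) ≠ 0 := by
    rw [← map_ofNat (algebraMap k L)]; exact (map_ne_zero _).2 h3
  have hL := hN.extNorm (L := L)
  have hinj := descentMap_injective hg'
  -- Both maps embed their source onto the same twisted fixed set, so composing one with the inverse
  -- of the other identifies $M$ with $M_x$.
  have hrange : LinearMap.range φ = LinearMap.range (descentMap hg') := by
    ext Z
    rw [hr, hN.forall_galois_iff hg', LinearMap.mem_range]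
    refine exists_congr fun X => ?_
    rw [descentMap_apply]
    constructor
    · intro h; rw [h, mu_inv_mu hg']
    · intro h; rw [← h, mu_mu_inv hg']
  let f : M ≃ₗ[k] J k C := LinearEquiv.ofInjective φ hφ ≪≫ₗ LinearEquiv.ofEq _ _ hrange ≪≫ₗ
    (LinearEquiv.ofInjective (descentMap hg') hinj).symm
  have hf : ∀ X, descentMap hg' (f X) = φ X := fun X =>
    congrArg Subtype.val ((LinearEquiv.ofInjective (descentMap hg') hinj).apply_symm_apply
      (LinearEquiv.ofEq _ _ hrange (LinearEquiv.ofInjective φ hφ X)))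
  refine ⟨f, fun X Y => hinj ?_, fun X => ?_⟩
  · rw [hN.descentMap_prodAt h3 hg' hx hgx', hf, hf, hf, hm]
  -- The subspaces were cut out with different points $g'$ and $g$ over $x$; $g^{-1}g'$ stabilizes
  -- $w$, so $\mu_{g^{-1}g'}$ preserves the diagonal and the two conditions agree.
  · have hw : act (g⁻¹ * g') basePt = basePt := by rw [act_mul, hgx', ← hgx, act_inv_act]
    rw [hn, mem_diagSubmodule, ← hL.mu_snd_eq_zero_iff h2' h3' (mul_mem (inv_mem hg) hg') hw,
      mu_mul (inv_mem hg), ← hf, descentMap_apply, descentMap_apply, mu_mu_inv hg']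

end Etale

end OctJordan

/-! ### The main theorem. -/

open OctJordan
theorem mainTheorem3 {k : Type u} {C : Type v} [Field k] [Invertible (2 : k)]
    (h3 : (3 : k) ≠ 0) [NonAssocRing C] [Module k C] [SMulCommClass k C C]
    [IsScalarTower k C C] (N : QuadraticForm k C) (hN : IsOctonion N)
    (L : Type u) [Field L] [Algebra k L] [IsSepClosure k L] :
    -- The map `S` is equivariant, and `S_w` is the Jordan product of `J`.
    (∀ X Y : J k C, S N basePt X Y = jmul N X Y) ∧
    (∀ g ∈ G N, ∀ (x : V k C) (X Y : J k C),
      S N (act g x) (g.1 X) (g.1 Y) =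
        (mult N g.1 ^ 3 * (g.2 : Matrix (Fin 2) (Fin 2) k).det ^ 4) • g.1 (S N x X Y)) ∧
    -- For semistable `x`, the bijection `μ_g : M_x → M_{gx}` is an isomorphism of algebras.
    (∀ g ∈ G N, ∀ x : V k C, Delta N x ≠ 0 →
      Delta N (act g x) ≠ 0 ∧ ∀ X Y : J k C,
        mu N g (prodAt N x X Y) = prodAt N (act g x) (mu N g X) (mu N g Y)) ∧
    -- The pairs that correspond to semistable points are twisted by automorphisms of `J`
    -- over `L` that preserve the subalgebra of diagonal matrices.
    (∀ h ∈ G (extNorm L N), act h basePt = basePt →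
      (∀ X Y, mu (extNorm L N) h (jmul (extNorm L N) X Y) =
        jmul (extNorm L N) (mu (extNorm L N) h X) (mu (extNorm L N) h Y)) ∧
      ∀ X, (mu (extNorm L N) h X).2 = 0 ↔ X.2 = 0) ∧
    -- For each semistable `x`, the algebra `M_x` is a `k`-form of `J`; it is, with some cubic
    -- étale subalgebra, a pair in `JIC(k)` that corresponds to `x`, and every pair that
    -- corresponds to `x` is equivalent to this one.
    ∀ x : V k C, Delta N x ≠ 0 →
      IsForm L N (prodAt N x) ∧
      ∃ n : Submodule k (J k C),
        IsJIC N (prodAt N x) n ∧ Corresponds L N x (prodAt N x) n ∧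
        ∀ (M : Type w) [AddCommGroup M] [Module k M] (m : M → M → M) (n' : Submodule k M),
          Corresponds L N x m n' → PairEquiv m n' (prodAt N x) n := by
  have h2 : (2 : k) ≠ 0 := (isUnit_of_invertible (2 : k)).ne_zero
  have h2' := two_ne_zero_of_invertible k L
  have h3' : (3 : L) ≠ 0 := by
    rw [← map_ofNat (algebraMap k L)]; exact (map_ne_zero _).2 h3
  have hL := hN.extNorm (L := L)
  have : IsSepClosed L := IsSepClosure.sep_closed k
  have : IsGalois k L := IsSepClosure.isGalois
  refine ⟨hN.S_basePt h2 h3, fun g hg x X Y => hN.S_act h2 h3 hg x X Y,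
    fun g hg x hx => ⟨hN.Delta_act_ne_zero h2 h3 hg hx, hN.mu_prodAt h2 h3 hg hx⟩,
    fun h hh hw => ⟨hL.mu_jmul h2' h3' hh hw, hL.mu_snd_eq_zero_iff h2' h3' hh hw⟩,
    fun x hx => ?_⟩
  obtain ⟨g, hg, hgx⟩ := hL.exists_act_basePt h2' h3' (x := baseV L x)
    (by rw [Delta_baseV]; exact (map_ne_zero _).2 hx)
  have hmul := hN.descentMap_prodAt h3 hg hx hgx
  refine ⟨⟨descentMap hg, isBaseChange_descentMap hg, hmul⟩, diagSubmodule hg,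
    hN.isJIC_diagSubmodule h3 hg hx hgx,
    ⟨g, hg, hgx, descentMap hg, descentMap_injective hg, fun Z => ?_, hmul, fun X => Iff.rfl⟩, ?_⟩
  · rw [hN.forall_galois_iff hg, LinearMap.mem_range]
    refine exists_congr fun X => ?_
    rw [descentMap_apply]
    constructor
    · intro h; rw [← h, mu_mu_inv hg]
    · intro h; rw [h, mu_inv_mu hg]
  · rintro M _ _ m n' ⟨g', hg', hgx', φ, hφ, hr, hm, hn⟩
    exact hN.pairEquiv_of_descent h3 hg hg' hx hgx hgx' φ hφ hr hm hn
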